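/- **Setting.** Consider a bipartite quantum system with Hilbert space $\mathbb{C}^{n_A}\otimes\mathbb{C}^{n_B}$, $n_A,n_B\ge 1$, and let $n=\min\{n_A,n_B\}$. States are density matrices. A measurement is a finite family $(E_i)_{i\in I}$ of positive semidefinite operators with $\sum_i E_i=\mathds{1}$. For a set $\mathcal M$ of measurements, two states $\rho,\sigma$ and $p\in[0,1]$, let $P_e^{\mathcal M}(\rho,\sigma;p)$ be the lowest probability of error in discriminating $\rho$ from $\sigma$, with a priori probabilities $p$ and $1-p$, by a measurement in $\mathcal M$ followed by a (possibly randomised) guess; equivalently $$P_e^{\mathcal M}(\rho,\sigma;p)=\tfrac12\Big(1-\sup_{(E_i)\in\mathcal M}\sum_i\big|\mathrm{Tr}\,E_i(p\rho-(1-p)\sigma)\big|\Big).$$ The data hiding ratio $R_{QM}(\mathcal M)$ is the supremum of all real $R\ge 1$ for which there are states $\rho,\sigma$ and $p\in[0,1]$ with $$P_e^{\mathrm{ALL}}(\rho,\sigma;p)=0,\qquad P_e^{\mathcal M}(\rho,\sigma;p)=\tfrac12\Big(1-\frac1R\Big),$$ where $\mathrm{ALL}$ is the set of all measurements. The following sets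 of measurements are considered. * $\mathrm{SEP}$: measurements all of whose effects are finite sums $\sum_k P_k\otimes Q_k$ with $P_k,Q_k\ge 0$. * $\mathrm{LOCC}$: measurements $(\Phi_i^*(\mathds{1}))_{i\in I}$, where $(\Phi_i)_{i\in I}$ is an LOCC instrument. Here an instrument is a finite family of completely positive maps whose sum preserves the trace. An instrument is one-way local if it is of the form $(\mathcal E_i\otimes \mathcal T_i)_i$, or of the same form with the parties exchanged, for an instrument $(\mathcal E_i)_i$ of one party and channels $\mathcal T_i$ of the other party. An instrument is LOCC-linked to $(\Phi_i)_i$ if it is a coarse graining of $(\mathcal F_{j|i}\circ\Phi_i)_{i,j}$ for one-way local instruments $(\mathcal F_{j|i})_j$. Finite-round LOCC instruments are those obtained from a coarse graining of a one-way local instrument by finitely many such links. An LOCC instrument is a limit of coarse grainings of finite-round LOCC instruments $J_1,J_2,\dots$ such that $J_{\nu+1}$ is LOCC-linked to $J_\nu$ for every $\nu$. * $\mathrm{LOCC}_\rightarrow$: all coarse grainings of measurements $(E_i\otimes F^{(i)}_j)_{(i,j)\in I\times J}$, where $(E_i)_{i\in I}$ is a measurement on the smaller subsystem and, for each $i$,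 $(F^{(i)}_j)_{j\in J}$ is a measurement on the larger one; that is, communication goes from the smaller to the larger subsystem (if $n_A=n_B$, either direction may be chosen). **Theorem.** With this notation, $$n\ \le\ R_{QM}(\mathrm{SEP})\ \le\ R_{QM}(\mathrm{LOCC})\ \le\ R_{QM}(\mathrm{LOCC}_\rightarrow)\ \le\ 2n-1 .$$ Moreover, if $n_A=n_B=n$, then $R_{QM}(\mathrm{SEP})=n$. -/

import Mathlib

open scoped Kronecker ENNReal Topology ComplexOrder

noncomputable section

namespace DataHiding

/-! States, measurements and coarse graining -/

/-- Density matrices. -/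
def IsState {d : Type} [Fintype d] (ρ : Matrix d d ℂ) : Prop :=
  ρ.PosSemidef ∧ ρ.trace = 1

/-- A class of finite measurements: `M I E` says that the family of effects `(E i)_{i ∈ I}`
belongs to the class. The effect `E` has probability `Tr (E ρ)` on the state `ρ`. -/
def MeasurementClass (d : Type) : Type 1 :=
  ∀ (I : Type) [Fintype I], (I → Matrix d d ℂ) → Prop

/-- All measurements (POVMs). -/
def ALL (d : Type) [Fintype d] [DecidableEq d] : MeasurementClass d :=
  fun I _ E => (∀ i : I, (E i).PosSemidef) ∧ ∑ i, E i = 1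

open Classical in
/-- Coarse graining of a family along a map of outcomes: `j ↦ ∑_{i : g i = j} E i`. -/
def coarse {V I J : Type} [AddCommMonoid V] [Fintype I] (g : I → J) (E : I → V) : J → V :=
  fun j => ∑ i : I with g i = j, E i

/-! State discrimination and the data hiding ratio -/

/-- The lowest probability of error when discriminating `ρ` (a priori probability `p`) from `σ`
(a priori probability `1 - p`) with measurements in `M`; on the outcome `i` the answer is `ρ` with
probability `q i` and `σ` with probability `1 - q i`. -/
def errorProb {d : Type} [Fintype d] (M : MeasurementClass d) (ρ σ : Matrix d d ℂ) (p : ℝ) : ℝ :=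
  sInf {ε : ℝ | ∃ (I : Type) (_ : Fintype I) (E : I → Matrix d d ℂ) (q : I → ℝ),
    M I E ∧ (∀ i, 0 ≤ q i ∧ q i ≤ 1) ∧
    ε = p * ∑ i, (1 - q i) * (E i * ρ).trace.re + (1 - p) * ∑ i, q i * (E i * σ).trace.re}

/-- There is data hiding against `M` with efficiency `R ≥ 1`. -/
def HasEfficiency {d : Type} [Fintype d] [DecidableEq d] (M : MeasurementClass d) (R : ℝ) : Prop :=
  1 ≤ R ∧ ∃ (ρ σ : Matrix d d ℂ) (p : ℝ), IsState ρ ∧ IsState σ ∧ 0 ≤ p ∧ p ≤ 1 ∧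
    errorProb (ALL d) ρ σ p = 0 ∧ errorProb M ρ σ p = (1 / 2) * (1 - 1 / R)

/-- The data hiding ratio against `M`: the supremum (in `[0, ∞]`) of all efficiencies. -/
def dhRatio {d : Type} [Fintype d] [DecidableEq d] (M : MeasurementClass d) : ℝ≥0∞ :=
  sSup {r : ℝ≥0∞ | ∃ R : ℝ, HasEfficiency M R ∧ r = ENNReal.ofReal R}

/-! Completely positive maps and instruments -/

/-- Linear maps on square matrices. -/
abbrev SuperOp (d : Type) : Type := Matrix d d ℂ →ₗ[ℂ] Matrix d d ℂ

/-- `φ ⊗ id`. -/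
def actLeft {a : Type} (b : Type) (φ : SuperOp a) : SuperOp (a × b) where
  toFun X := Matrix.of fun x y => φ (Matrix.of fun i j => X (i, x.2) (j, y.2)) x.1 y.1
  map_add' X Y := by
    ext x y
    exact congrFun (congrFun (φ.map_add (Matrix.of fun i j => X (i, x.2) (j, y.2))
      (Matrix.of fun i j => Y (i, x.2) (j, y.2))) x.1) y.1
  map_smul' c X := by
    ext x y
    exact congrFun (congrFun (φ.map_smul c (Matrix.of fun i j => X (i, x.2) (j, y.2))) x.1) y.1

/-- `id ⊗ ψ`. -/
def actRight (a : Type) {b : Type} (ψ : SuperOp b) : SuperOp (a × b) where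
  toFun X := Matrix.of fun x y => ψ (Matrix.of fun i j => X (x.1, i) (y.1, j)) x.2 y.2
  map_add' X Y := by
    ext x y
    exact congrFun (congrFun (ψ.map_add (Matrix.of fun i j => X (x.1, i) (y.1, j))
      (Matrix.of fun i j => Y (x.1, i) (y.1, j))) x.2) y.2
  map_smul' c X := by
    ext x y
    exact congrFun (congrFun (ψ.map_smul c (Matrix.of fun i j => X (x.1, i) (y.1, j))) x.2) y.2

/-- `φ ⊗ ψ`. -/
def tensorMap {a b : Type} (φ : SuperOp a) (ψ : SuperOp b) : SuperOp (a × b) :=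
  actLeft b φ ∘ₗ actRight a ψ

/-- Complete positivity: `φ ⊗ id_k` preserves positive semidefiniteness for every `k`. -/
def IsCP {a : Type} [Fintype a] (φ : SuperOp a) : Prop :=
  ∀ (k : ℕ) (X : Matrix (a × Fin k) (a × Fin k) ℂ),
    X.PosSemidef → (actLeft (Fin k) φ X).PosSemidef

/-- Instruments: finite families of completely positive maps whose sum preserves the trace. -/
def IsInstrument {a I : Type} [Fintype a] [Fintype I] (Φ : I → SuperOp a) : Prop :=
  (∀ i, IsCP (Φ i)) ∧ ∀ X : Matrix a a ℂ, ∑ i, (Φ i X).trace = X.trace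

/-- Channels: completely positive trace-preserving maps. -/
def IsChannel {a : Type} [Fintype a] (φ : SuperOp a) : Prop :=
  IsCP φ ∧ ∀ X : Matrix a a ℂ, (φ X).trace = X.trace

/-! LOCC instruments -/

/-- Instruments that are one-way local: one of the two parties applies an instrument and sends the
outcome to the other party, who then applies a channel depending on it. -/
def IsOneWayLocal {a b I : Type} [Fintype a] [Fintype b] [Fintype I]
    (Φ : I → SuperOp (a × b)) : Prop :=
  (∃ (E : I → SuperOp a) (T : I → SuperOp b), IsInstrument E ∧ (∀ i, IsChannel (T i)) ∧
    ∀ i, Φ i = tensorMap (E i) (T i)) ∨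
  (∃ (T : I → SuperOp a) (E : I → SuperOp b), (∀ i, IsChannel (T i)) ∧ IsInstrument E ∧
    ∀ i, Φ i = tensorMap (T i) (E i))

/-- `Ψ` is LOCC-linked to `Φ`: after `Φ`, a one-way local instrument (for either party) that may
depend on the outcome of `Φ` is applied, followed by a coarse graining. -/
def IsLinked {a b I K : Type} [Fintype a] [Fintype b] [Fintype I]
    (Φ : I → SuperOp (a × b)) (Ψ : K → SuperOp (a × b)) : Prop :=
  ∃ (J : I → Type) (_ : ∀ i, Fintype (J i)) (F : ∀ i, J i → SuperOp (a × b))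
    (g : (Σ i, J i) → K), (∀ i, IsOneWayLocal (F i)) ∧
    Ψ = coarse g fun x : (Σ i, J i) => F x.1 x.2 ∘ₗ Φ x.1

/-- LOCC instruments with finitely many rounds. -/
inductive IsFiniteLOCC {a b : Type} [Fintype a] [Fintype b] :
    ∀ {I : Type} [Fintype I], (I → SuperOp (a × b)) → Prop
  | one {I K : Type} [Fintype I] [Fintype K] (Φ : I → SuperOp (a × b)) (g : I → K)
      (hΦ : IsOneWayLocal Φ) : IsFiniteLOCC (coarse g Φ)
  | link {I K : Type} [Fintype I] [Fintype K] (Φ : I → SuperOp (a × b)) (Ψ : K → SuperOp (a × b))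
      (hΦ : IsFiniteLOCC Φ) (hΨ : IsLinked Φ Ψ) : IsFiniteLOCC Ψ

/-- LOCC instruments, possibly with infinitely many rounds: limits of coarse grainings of
finite-round LOCC instruments, each of which continues the preceding one. -/
def IsLOCCInstrument {a b I : Type} [Fintype a] [Fintype b] (Φ : I → SuperOp (a × b)) : Prop :=
  ∃ (K : ℕ → Type) (_ : ∀ ν, Fintype (K ν)) (Ψ : ∀ ν, K ν → SuperOp (a × b))
    (g : ∀ ν, K ν → I), (∀ ν, IsFiniteLOCC (Ψ ν)) ∧ (∀ ν, IsLinked (Ψ ν) (Ψ (ν + 1))) ∧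
    ∀ (i : I) (X : Matrix (a × b) (a × b) ℂ),
      Filter.Tendsto (fun ν => coarse (g ν) (Ψ ν) i X) Filter.atTop (𝓝 (Φ i X))

/-! Locally constrained classes of measurements on a bipartite system `a × b` -/

/-- Separable positive operators: finite sums of `P ⊗ Q` with `P, Q` positive semidefinite. -/
def IsSeparable {a b : Type} [Fintype a] [Fintype b] (W : Matrix (a × b) (a × b) ℂ) : Prop :=
  ∃ (K : Type) (_ : Fintype K) (P : K → Matrix a a ℂ) (Q : K → Matrix b b ℂ),
    (∀ k, (P k).PosSemidef) ∧ (∀ k, (Q k).PosSemidef) ∧ W = ∑ k, P k ⊗ₖ Q k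

/-- Separable measurements. -/
def SEP (a b : Type) [Fintype a] [Fintype b] [DecidableEq a] [DecidableEq b] :
    MeasurementClass (a × b) :=
  fun I _ E => ALL (a × b) I E ∧ ∀ i, IsSeparable (E i)

/-- LOCC measurements: `E i = Φ_i^*(1)` for an LOCC instrument `Φ`. -/
def LOCC (a b : Type) [Fintype a] [Fintype b] : MeasurementClass (a × b) :=
  fun I _ E => ∃ Φ : I → SuperOp (a × b), IsLOCCInstrument Φ ∧
    ∀ (i : I) (X : Matrix (a × b) (a × b) ℂ), (E i * X).trace = (Φ i X).trace

/-- One-way LOCC measurements with communication from the first to the second party. -/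
def LOCCAtoB (a b : Type) [Fintype a] [Fintype b] [DecidableEq a] [DecidableEq b] :
    MeasurementClass (a × b) :=
  fun K _ M => ∃ (I J : Type) (_ : Fintype I) (_ : Fintype J) (E : I → Matrix a a ℂ)
    (F : I → J → Matrix b b ℂ) (g : I × J → K), ALL a I E ∧ (∀ i, ALL b J (F i)) ∧
    M = coarse g fun x => E x.1 ⊗ₖ F x.1 x.2

/-- One-way LOCC measurements with communication from the second to the first party. -/
def LOCCBtoA (a b : Type) [Fintype a] [Fintype b] [DecidableEq a] [DecidableEq b] :
    MeasurementClass (a × b) :=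
  fun K _ M => ∃ (I J : Type) (_ : Fintype I) (_ : Fintype J) (F : I → Matrix b b ℂ)
    (E : I → J → Matrix a a ℂ) (g : I × J → K), ALL b I F ∧ (∀ i, ALL a J (E i)) ∧
    M = coarse g fun x => E x.1 x.2 ⊗ₖ F x.1

end DataHiding

end

set_option linter.unusedSectionVars false

noncomputable section

namespace DataHiding

/-! Traces of products of positive semidefinite matrices -/

/-! Write X = pρ - (1-p)σ. Perfect discrimination means that tests 0 ≤ P ≤ 1 exist with Tr (2P-1)X
arbitrarily close to 1, and a binary measurement (E₊, E₋) of a class bounds |Tr (E₊-E₋)X| by 1 -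
2Pₑ. So the ratio of a class is at most c as soon as every D = 2P-1 is a combination of differences
E₊-E₋ from that class with total weight c (`Perfect.errorProb_le_of_forall`).

One-way LOCC, weight 2n-1: let the smaller party measure vectors of random phases z and the other
party test with ⟨z|D|z⟩/n. On average this gives 1/n times D with each diagonal block replaced by
the sum of all of them. The excess, the blocks k ≠ i in place i, comes from a measurement in the
standard basis followed by a test with their mean. The weights are n and n-1
(`eq_sum_phaseEffect_sub`).

SEP with equal dimensions, weight n: D/n lies in the Hilbert–Schmidt unit ball, so 1 ± D/n are
separable by the Gurvits–Barnum theorem (`isSeparable_one_add`), and their halves form a measurement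
with difference D/n.

Lower bound n: for the extreme Werner states with suitable priors X = F/n², F the flip. Since Tr
(P⊗Q)F = Tr PQ ≥ 0, separable measurements gain only Tr F/n² = 1/n, whereas the projection onto the
symmetric subspace makes no error (`exists_perfect_werner`).

The middle inequalities compare error probabilities: one-way measurements are LOCC, and LOCC
measurements are limits of separable ones, because adjoints of finite-round instruments preserve
separability. -/

lemma trace_mul_nonneg {d : Type} [Fintype d] {A B : Matrix d d ℂ}
    (hA : A.PosSemidef) (hB : B.PosSemidef) : 0 ≤ (A * B).trace := by
  classical
  obtain ⟨C, rfl⟩ : ∃ C : Matrix d d ℂ, A = C.conjTranspose * C := by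
    open scoped MatrixOrder in
    exact CStarAlgebra.nonneg_iff_eq_star_mul_self.mp hA.nonneg
  rw [Matrix.mul_assoc, Matrix.trace_mul_comm]
  exact (hB.mul_mul_conjTranspose_same C).trace_nonneg

lemma trace_mul_re_nonneg {d : Type} [Fintype d] {A B : Matrix d d ℂ}
    (hA : A.PosSemidef) (hB : B.PosSemidef) : 0 ≤ (A * B).trace.re :=
  (Complex.nonneg_iff.mp (trace_mul_nonneg hA hB)).1

lemma sum_coarse {V I J : Type} [AddCommMonoid V] [Fintype I] [Fintype J] (g : I → J)
    (E : I → V) : ∑ j, coarse g E j = ∑ i, E i := by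
  classical
  simp only [coarse]
  convert Finset.sum_fiberwise Finset.univ g E

lemma sum_kronecker {a b I : Type} (s : Finset I) (P : I → Matrix a a ℂ) (Q : Matrix b b ℂ) :
    ∑ i ∈ s, P i ⊗ₖ Q = (∑ i ∈ s, P i) ⊗ₖ Q := by
  ext x y
  simp [Matrix.sum_apply, Matrix.kroneckerMap_apply, Finset.sum_mul]

lemma kronecker_sum {a b I : Type} (s : Finset I) (P : Matrix a a ℂ) (Q : I → Matrix b b ℂ) :
    ∑ i ∈ s, P ⊗ₖ Q i = P ⊗ₖ ∑ i ∈ s, Q i := by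
  ext x y
  simp [Matrix.sum_apply, Matrix.kroneckerMap_apply, Finset.mul_sum]

/-! Error probabilities -/

/-- The difference of the two states, weighted with their a priori probabilities. -/
def weighted {d : Type} (ρ σ : Matrix d d ℂ) (p : ℝ) : Matrix d d ℂ :=
  (p : ℂ) • ρ - ((1 - p : ℝ) : ℂ) • σ

lemma trace_mul_weighted_re {d : Type} [Fintype d] (E ρ σ : Matrix d d ℂ) (p : ℝ) :
    (E * weighted ρ σ p).trace.re = p * (E * ρ).trace.re - (1 - p) * (E * σ).trace.re := by
  simp only [weighted, Matrix.mul_sub, Matrix.mul_smul, Matrix.trace_sub, Matrix.trace_smul,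
    smul_eq_mul, Complex.sub_re, Complex.re_ofReal_mul]

/-- Two states and a priori probabilities for which discrimination without error is possible. -/
structure Perfect {d : Type} [Fintype d] [DecidableEq d] (ρ σ : Matrix d d ℂ) (p : ℝ) :
    Prop where
  left : IsState ρ
  right : IsState σ
  nonneg : 0 ≤ p
  le_one : p ≤ 1
  error : errorProb (ALL d) ρ σ p = 0

/-- Nonemptiness `hne` excludes the default value `sInf ∅ = 0`. -/
lemma le_errorProb {d : Type} [Fintype d] {M : MeasurementClass d} {ρ σ : Matrix d d ℂ}
    {p c : ℝ} (hne : ∃ (I : Type) (_ : Fintype I) (E : I → Matrix d d ℂ), M I E)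
    (h : ∀ (I : Type) [Fintype I] (E : I → Matrix d d ℂ) (q : I → ℝ), M I E →
      (∀ i, 0 ≤ q i ∧ q i ≤ 1) →
      c ≤ p * ∑ i, (1 - q i) * (E i * ρ).trace.re + (1 - p) * ∑ i, q i * (E i * σ).trace.re) :
    c ≤ errorProb M ρ σ p := by
  obtain ⟨I, _, E, hE⟩ := hne
  refine le_csInf ⟨_, I, _, E, fun _ => 0, hE, fun _ => ⟨le_rfl, zero_le_one⟩, rfl⟩ ?_
  rintro _ ⟨J, _, E', q', hE', hq', rfl⟩
  exact h J E' q' hE' hq'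

section

variable {d : Type} [Fintype d] [DecidableEq d]

lemma sum_trace_re_of_sum_eq_one {I : Type} [Fintype I] {E : I → Matrix d d ℂ}
    (hE : ∑ i, E i = 1) {ρ : Matrix d d ℂ} (hρ : IsState ρ) :
    ∑ i, (E i * ρ).trace.re = 1 := by
  rw [← Complex.re_sum, ← Matrix.trace_sum, ← Finset.sum_mul, hE, one_mul, hρ.2, Complex.one_re]

/-- Splitting off the fair guess `q = 1/2`, which errs with probability 1/2, leaves a term that sees
the states only through their weighted difference. -/
lemma error_eq {I : Type} [Fintype I] {E : I → Matrix d d ℂ}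
    (hE : ∑ i, E i = 1) {ρ σ : Matrix d d ℂ} (hρ : IsState ρ) (hσ : IsState σ) (p : ℝ)
    (q : I → ℝ) :
    p * ∑ i, (1 - q i) * (E i * ρ).trace.re + (1 - p) * ∑ i, q i * (E i * σ).trace.re =
      1 / 2 - ∑ i, (q i - 1 / 2) * (E i * weighted ρ σ p).trace.re := by
  have h1 := sum_trace_re_of_sum_eq_one hE hρ
  have h2 := sum_trace_re_of_sum_eq_one hE hσ
  have h3 : ∀ i, (q i - 1 / 2) * (E i * weighted ρ σ p).trace.re =
      1 / 2 * (p * (E i * ρ).trace.re) + 1 / 2 * ((1 - p) * (E i * σ).trace.re)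
      - p * ((1 - q i) * (E i * ρ).trace.re) - (1 - p) * (q i * (E i * σ).trace.re) := by
    intro i; rw [trace_mul_weighted_re]; ring
  simp only [h3, Finset.sum_sub_distrib, Finset.sum_add_distrib, ← Finset.mul_sum, h1, h2]
  ring

lemma error_nonneg {I : Type} [Fintype I] {E : I → Matrix d d ℂ} (hE : ALL d I E)
    {ρ σ : Matrix d d ℂ} (hρ : IsState ρ) (hσ : IsState σ) {p : ℝ} (hp : 0 ≤ p) (hp1 : p ≤ 1)
    {q : I → ℝ} (hq : ∀ i, 0 ≤ q i ∧ q i ≤ 1) :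
    0 ≤ p * ∑ i, (1 - q i) * (E i * ρ).trace.re + (1 - p) * ∑ i, q i * (E i * σ).trace.re := by
  refine add_nonneg (mul_nonneg hp (Finset.sum_nonneg fun i _ => mul_nonneg ?_ ?_))
    (mul_nonneg (sub_nonneg.mpr hp1) (Finset.sum_nonneg fun i _ => mul_nonneg (hq i).1 ?_))
  · linarith [(hq i).2]
  · exact trace_mul_re_nonneg (hE.1 i) hρ.1
  · exact trace_mul_re_nonneg (hE.1 i) hσ.1

variable {M M' : MeasurementClass d} {ρ σ : Matrix d d ℂ} {p : ℝ}

lemma errorProb_le (hM : ∀ (I : Type) [Fintype I] (E : I → Matrix d d ℂ), M I E → ALL d I E)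
    (hρ : IsState ρ) (hσ : IsState σ) (hp : 0 ≤ p) (hp1 : p ≤ 1)
    {I : Type} [Fintype I] {E : I → Matrix d d ℂ} (hE : M I E)
    {q : I → ℝ} (hq : ∀ i, 0 ≤ q i ∧ q i ≤ 1) :
    errorProb M ρ σ p ≤
      p * ∑ i, (1 - q i) * (E i * ρ).trace.re + (1 - p) * ∑ i, q i * (E i * σ).trace.re := by
  refine csInf_le ⟨0, ?_⟩ ⟨I, _, E, q, hE, hq, rfl⟩
  rintro _ ⟨J, _, E', q', hE', hq', rfl⟩
  exact error_nonneg (hM J E' hE') hρ hσ hp hp1 hq'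

lemma errorProb_nonneg (hM : ∀ (I : Type) [Fintype I] (E : I → Matrix d d ℂ), M I E → ALL d I E)
    (hρ : IsState ρ) (hσ : IsState σ) (hp : 0 ≤ p) (hp1 : p ≤ 1) :
    0 ≤ errorProb M ρ σ p := by
  refine Real.sInf_nonneg ?_
  rintro _ ⟨J, _, E', q', hE', hq', rfl⟩
  exact error_nonneg (hM J E' hE') hρ hσ hp hp1 hq'

/-- A binary measurement and its reversal bound the error probability. -/
lemma abs_trace_le_of_binary
    (hM : ∀ (I : Type) [Fintype I] (E : I → Matrix d d ℂ), M I E → ALL d I E)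
    (hρ : IsState ρ) (hσ : IsState σ) (hp : 0 ≤ p) (hp1 : p ≤ 1)
    {E : Bool → Matrix d d ℂ} (hE : M Bool E) :
    |((E true - E false) * weighted ρ σ p).trace.re| ≤ 1 - 2 * errorProb M ρ σ p := by
  have hs := (hM _ _ hE).2
  have h1 := errorProb_le hM hρ hσ hp hp1 hE (q := fun b => if b then 1 else 0)
    (by intro b; cases b <;> simp)
  have h2 := errorProb_le hM hρ hσ hp hp1 hE (q := fun b => if b then 0 else 1)
    (by intro b; cases b <;> simp)
  rw [error_eq hs hρ hσ] at h1 h2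
  simp only [Fintype.sum_bool, if_true, Bool.false_eq_true, if_false] at h1 h2
  rw [Matrix.sub_mul, Matrix.trace_sub, Complex.sub_re, abs_le]
  constructor <;> linarith

/-- An error probability is bounded if every binary test is approximated up to a factor. -/
lemma Perfect.errorProb_le_of_forall (h : Perfect ρ σ p) {c : ℝ} (hc : 0 < c)
    (hb : ∀ P : Matrix d d ℂ, P.PosSemidef → (1 - P).PosSemidef →
      (((2 : ℂ) • P - 1) * weighted ρ σ p).trace.re ≤ c * (1 - 2 * errorProb M ρ σ p)) :
    errorProb M ρ σ p ≤ 1 / 2 * (1 - 1 / c) := by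
  have key : 1 ≤ c * (1 - 2 * errorProb M ρ σ p) := by
    -- The value 0 is an infimum, so a measurement with error below ε/2 is taken. Its randomised
    -- guesses fold the outcomes into the single test `∑ q i • E i`.
    refine le_of_forall_pos_le_add fun ε hε => ?_
    have hlt : errorProb (ALL d) ρ σ p < ε / 2 := by rw [h.error]; positivity
    unfold errorProb at hlt
    obtain ⟨_, ⟨I, _, E, q, hE, hq, rfl⟩, hlt'⟩ := exists_lt_of_csInf_lt (by
      exact ⟨_, Unit, inferInstance, fun _ => 1, fun _ => 0,
        ⟨fun _ => Matrix.PosSemidef.one, by simp⟩, fun _ => ⟨le_rfl, zero_le_one⟩, rfl⟩) hlt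
    rw [error_eq hE.2 h.left h.right] at hlt'
    have hP : (∑ i, (q i : ℂ) • E i).PosSemidef :=
      Matrix.posSemidef_sum _ fun i _ => (hE.1 i).smul (by exact_mod_cast (hq i).1)
    have hP' : (1 - ∑ i, (q i : ℂ) • E i).PosSemidef := by
      rw [← hE.2, ← Finset.sum_sub_distrib]
      refine Matrix.posSemidef_sum _ fun i _ => ?_
      have : E i - (q i : ℂ) • E i = ((1 - q i : ℝ) : ℂ) • E i := by
        rw [Complex.ofReal_sub, sub_smul, Complex.ofReal_one, one_smul]
      rw [this]
      exact (hE.1 i).smul (by exact_mod_cast sub_nonneg.mpr (hq i).2)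
    have := hb _ hP hP'
    have e : (2 : ℂ) • (∑ i, (q i : ℂ) • E i) - 1 =
        ∑ i, ((2 * (q i - 1 / 2) : ℝ) : ℂ) • E i := by
      rw [← hE.2, Finset.smul_sum, ← Finset.sum_sub_distrib]
      refine Finset.sum_congr rfl fun i _ => ?_
      rw [smul_smul]; nth_rewrite 2 [← one_smul ℂ (E i)]; rw [← sub_smul]; congr 1
      push_cast; ring
    rw [e, Finset.sum_mul, Matrix.trace_sum, Complex.re_sum] at this
    simp only [Matrix.smul_mul, Matrix.trace_smul, smul_eq_mul, Complex.re_ofReal_mul,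
      mul_assoc, ← Finset.mul_sum] at this
    linarith
  have : 1 / c ≤ 1 - 2 * errorProb M ρ σ p := by rwa [div_le_iff₀' hc]
  linarith

/-! The data hiding ratio -/

lemma dhRatio_le {c : ℝ} (hc : 0 < c)
    (h : ∀ ρ σ p, Perfect ρ σ p → errorProb M ρ σ p ≤ 1 / 2 * (1 - 1 / c)) :
    dhRatio M ≤ ENNReal.ofReal c := by
  refine sSup_le ?_
  rintro _ ⟨R, ⟨hR, ρ, σ, p, hρ, hσ, hp, hp1, h0, he⟩, rfl⟩
  have := h ρ σ p ⟨hρ, hσ, hp, hp1, h0⟩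
  rw [he] at this
  exact ENNReal.ofReal_le_ofReal ((one_div_le_one_div hc (by linarith)).mp (by linarith))

/-- The pair has efficiency exactly `1 / (1 - 2 * errorProb M ρ σ p)`; the strict bound `h2` makes
this a positive real number. -/
lemma Perfect.le_dhRatio (h : Perfect ρ σ p) {c : ℝ} (hc : 1 ≤ c)
    (h1 : 1 / 2 * (1 - 1 / c) ≤ errorProb M ρ σ p) (h2 : errorProb M ρ σ p < 1 / 2) :
    ENNReal.ofReal c ≤ dhRatio M := by
  have hpos : 0 < 1 - 2 * errorProb M ρ σ p := by linarith
  have hcR : c ≤ 1 / (1 - 2 * errorProb M ρ σ p) := by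
    rw [le_one_div (by linarith) hpos]; linarith
  refine (ENNReal.ofReal_le_ofReal hcR).trans (le_sSup ⟨_, ⟨hc.trans hcR, ρ, σ, p, h.left,
    h.right, h.nonneg, h.le_one, h.error, ?_⟩, rfl⟩)
  rw [one_div_one_div]; ring

/-- A larger error probability means a larger efficiency of the same pair. At error 1/2 no real
efficiency would be left, which `h'` rules out. -/
lemma dhRatio_mono
    (h : ∀ ρ σ p, Perfect ρ σ p → errorProb M ρ σ p ≤ errorProb M' ρ σ p)
    (h' : ∀ ρ σ p, Perfect ρ σ p → errorProb M' ρ σ p < 1 / 2) :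
    dhRatio M ≤ dhRatio M' := by
  refine sSup_le ?_
  rintro _ ⟨R, ⟨hR, ρ, σ, p, hρ, hσ, hp, hp1, h0, he⟩, rfl⟩
  have hP : Perfect ρ σ p := ⟨hρ, hσ, hp, hp1, h0⟩
  exact hP.le_dhRatio hR (he ▸ h ρ σ p hP) (h' ρ σ p hP)

end

section

variable {a b : Type} [Fintype a] [Fintype b] [DecidableEq a] [DecidableEq b]

/-! One-way measurements are measurements -/

lemma ALL.coarse {d I J : Type} [Fintype d] [DecidableEq d] [Fintype I] [Fintype J]
    {E : I → Matrix d d ℂ} (hE : ALL d I E) (g : I → J) : ALL d J (coarse g E) :=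
  ⟨fun _ => Matrix.posSemidef_sum _ fun i _ => hE.1 i, by rw [sum_coarse, hE.2]⟩

lemma LOCCAtoB_le_ALL (K : Type) [Fintype K] (M : K → Matrix (a × b) (a × b) ℂ)
    (hM : LOCCAtoB a b K M) : ALL (a × b) K M := by
  obtain ⟨I, J, _, _, E, F, g, hE, hF, rfl⟩ := hM
  refine ALL.coarse ⟨fun x => (hE.1 _).kronecker ((hF _).1 _), ?_⟩ g
  rw [Fintype.sum_prod_type]
  simp only [kronecker_sum, (hF _).2]
  rw [sum_kronecker, hE.2, Matrix.one_kronecker_one]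

/-- The binary one-way measurement in which the first party measures `E` and the second party
is left with the image of a binary test under a unital positive map depending on the outcome. -/
lemma binary_mem_LOCCAtoB {I : Type} [Fintype I] {E : I → Matrix a a ℂ} (hE : ALL a I E)
    (G : I → Matrix (a × b) (a × b) ℂ →ₗ[ℂ] Matrix b b ℂ) (hG1 : ∀ i, G i 1 = 1)
    (hG : ∀ i X, X.PosSemidef → (G i X).PosSemidef) {P : Matrix (a × b) (a × b) ℂ}
    (hP : P.PosSemidef) (hP' : (1 - P).PosSemidef) :
    LOCCAtoB a b Bool fun s => ∑ i, E i ⊗ₖ G i (if s then P else 1 - P) := by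
  refine ⟨I, Bool, inferInstance, inferInstance, E, fun i s => G i (if s then P else 1 - P),
    Prod.snd, hE, fun i => ⟨?_, ?_⟩, ?_⟩
  · rintro (_ | _)
    · exact hG _ _ hP'
    · exact hG _ _ hP
  · simp [hG1]
  · funext s
    simp only [coarse, Finset.sum_filter, Fintype.sum_prod_type]
    refine Finset.sum_congr rfl fun i _ => ?_
    cases s <;> simp

/-- `2P - 1 = P - (1 - P)` is a difference of complementary effects, and unital positive maps send
these to complementary effects of the second party. -/
lemma abs_trace_le_of_unital {ρ σ : Matrix (a × b) (a × b) ℂ} {p : ℝ} (h : Perfect ρ σ p)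
    {I : Type} [Fintype I] {E : I → Matrix a a ℂ} (hE : ALL a I E)
    (G : I → Matrix (a × b) (a × b) ℂ →ₗ[ℂ] Matrix b b ℂ) (hG1 : ∀ i, G i 1 = 1)
    (hG : ∀ i X, X.PosSemidef → (G i X).PosSemidef) {P : Matrix (a × b) (a × b) ℂ}
    (hP : P.PosSemidef) (hP' : (1 - P).PosSemidef) :
    |((∑ i, E i ⊗ₖ G i ((2 : ℂ) • P - 1)) * weighted ρ σ p).trace.re| ≤
      1 - 2 * errorProb (LOCCAtoB a b) ρ σ p := by
  have := abs_trace_le_of_binary LOCCAtoB_le_ALL h.left h.right h.nonneg h.le_one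
    (binary_mem_LOCCAtoB hE G hG1 hG hP hP')
  convert this using 5
  rw [← Finset.sum_sub_distrib]
  refine Finset.sum_congr rfl fun i _ => ?_
  have : (2 : ℂ) • P - 1 = P - (1 - P) := by rw [two_smul]; abel
  rw [this, map_sub]
  ext x y
  simp [Matrix.kroneckerMap_apply, mul_sub]

/-! Contraction with a vector of the first party -/

/-- The isometry (up to a factor) `y ↦ v ⊗ y`. -/
def tensorLeft (b : Type) [DecidableEq b] (v : a → ℂ) : Matrix (a × b) b ℂ :=
  Matrix.of fun x y => if x.2 = y then v x.1 else 0

/-- The partial expectation value `⟨v| X |v⟩` of an operator of the bipartite system. -/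
def contract (v : a → ℂ) : Matrix (a × b) (a × b) ℂ →ₗ[ℂ] Matrix b b ℂ where
  toFun X := (tensorLeft b v).conjTranspose * X * tensorLeft b v
  map_add' X Y := by rw [Matrix.mul_add, Matrix.add_mul]
  map_smul' c X := by simp

lemma contract_apply (v : a → ℂ) (X : Matrix (a × b) (a × b) ℂ) (y y' : b) :
    contract v X y y' = ∑ k, ∑ l, star (v k) * v l * X (k, y) (l, y') := by
  simp only [contract, LinearMap.coe_mk, AddHom.coe_mk, Matrix.mul_apply, tensorLeft,
    Matrix.conjTranspose_apply, Matrix.of_apply, Fintype.sum_prod_type, apply_ite star, star_zero,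
    ite_mul, zero_mul, mul_ite, mul_zero, Finset.sum_ite_eq', Finset.mem_univ, if_true,
    Finset.sum_mul]
  rw [Finset.sum_comm]
  refine Finset.sum_congr rfl fun k _ => Finset.sum_congr rfl fun l _ => ?_
  ring

lemma contract_posSemidef (v : a → ℂ) {X : Matrix (a × b) (a × b) ℂ} (hX : X.PosSemidef) :
    (contract v X).PosSemidef :=
  hX.conjTranspose_mul_mul_same _

lemma contract_one (v : a → ℂ) :
    contract v (1 : Matrix (a × b) (a × b) ℂ) = (∑ k, star (v k) * v k) • 1 := by
  ext y y'
  rw [contract_apply]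
  simp [Matrix.one_apply, ite_and]

lemma contract_single_apply (k : a) (X : Matrix (a × b) (a × b) ℂ) (y y' : b) :
    contract (Pi.single k 1) X y y' = X (k, y) (k, y') := by
  rw [contract_apply, Finset.sum_eq_single k, Finset.sum_eq_single k] <;>
    simp +contextual [Pi.single_apply]

/-! Random phases -/

/-- The vector of phases given by third roots of unity. -/
def phase (z : a → ZMod 3) (x : a) : ℂ := ZMod.stdAddChar (z x)

lemma star_phase (z : a → ZMod 3) (x : a) : star (phase z x) = ZMod.stdAddChar (-z x) := by
  rw [AddChar.map_neg_eq_conj]; rfl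

lemma star_phase_mul_self (z : a → ZMod 3) (x : a) : star (phase z x) * phase z x = 1 := by
  rw [star_phase, phase, ← AddChar.map_add_eq_mul, neg_add_cancel, AddChar.map_zero_eq_one]

/-- The summand is a character of `z` with exponent `z x - z x' - z k + z l`, so the sum vanishes
unless the exponent does identically. Signs in place of third roots of unity would let the pairing
`x = l`, `x' = k` survive as well. -/
lemma sum_phase (x x' k l : a) :
    ∑ z, phase z x * star (phase z x') * (star (phase z k) * phase z l) =
      if (x = x' ∧ k = l) ∨ (x = k ∧ x' = l) then (3 : ℂ) ^ Fintype.card a else 0 := by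
  let ev (x : a) : (a → ZMod 3) →+ ZMod 3 := Pi.evalAddMonoidHom (fun _ => ZMod 3) x
  let f : (a → ZMod 3) →+ ZMod 3 := ev x - ev x' - ev k + ev l
  have hf : ∀ z, f z = z x - z x' - z k + z l := fun z => rfl
  have h1 : ∀ z, phase z x * star (phase z x') * (star (phase z k) * phase z l) =
      (ZMod.stdAddChar.compAddMonoidHom f : AddChar (a → ZMod 3) ℂ) z := by
    intro z
    rw [star_phase, star_phase, phase, phase, ← AddChar.map_add_eq_mul, ← AddChar.map_add_eq_mul,
      ← AddChar.map_add_eq_mul, AddChar.compAddMonoidHom_apply, hf]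
    congr 1; ring
  simp only [h1]
  split_ifs with h
  · have : ∀ z, f z = 0 := by
      intro z; rw [hf]
      rcases h with ⟨rfl, rfl⟩ | ⟨rfl, rfl⟩ <;> ring
    simp [AddChar.compAddMonoidHom_apply, this, ZMod.card]
  · refine AddChar.sum_eq_zero_of_ne_one fun h0 => ?_
    have h2 : ∀ z, f z = 0 := fun z => by
      have := DFunLike.congr_fun h0 z
      rw [AddChar.compAddMonoidHom_apply, AddChar.one_apply,
        ← AddChar.map_zero_eq_one (ZMod.stdAddChar (N := 3))] at this
      exact ZMod.injective_stdAddChar this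
    push Not at h
    -- The coefficient of `z m` in the exponent, read off at a unit vector.
    have h3 : ∀ m, ((if x = m then 1 else 0) - (if x' = m then 1 else 0)
        - (if k = m then 1 else 0) + (if l = m then 1 else 0) : ZMod 3) = 0 := by
      intro m
      have := h2 (Pi.single m 1)
      rw [hf] at this
      simpa [Pi.single_apply] using this
    by_cases hx : x = x'
    · have hkl := h.1 hx
      subst hx
      have := h3 k
      simp [hkl.symm] at this
    · by_cases hk : x = k
      · have hl := h.2 hk
        subst hk
        have := h3 x'
        simp [hx, hl.symm] at this
      -- Here `x` differs from `x'` and `k`, so its coefficient is 1 or 2, which is nonzero modulo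
      -- 3.
      · have := h3 x
        rw [if_pos rfl, if_neg (Ne.symm hx), if_neg (Ne.symm hk)] at this
        split_ifs at this <;> revert this <;> decide

/-- The measurement of the first party in the random bases of phases. -/
def phaseEffect (z : a → ZMod 3) : Matrix a a ℂ :=
  ((3 : ℂ) ^ Fintype.card a)⁻¹ • Matrix.vecMulVec (phase z) (star (phase z))

lemma phaseEffect_mem_ALL : ALL a (a → ZMod 3) phaseEffect := by
  refine ⟨fun z => (Matrix.posSemidef_vecMulVec_self_star _).smul (by positivity), ?_⟩
  ext x x'
  have := sum_phase x x' x x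
  simp only [star_phase_mul_self, mul_one] at this
  simp only [phaseEffect, Matrix.sum_apply, Matrix.smul_apply, Matrix.vecMulVec_apply, Pi.star_apply,
    smul_eq_mul, ← Finset.mul_sum, this, Matrix.one_apply]
  by_cases h : x = x'
  · simp [h]
  · simp [h, Ne.symm h]

/-- In `sum_phase` the pairing `k = l` occurs only on diagonal blocks and yields the partial trace;
the other pairing returns the block itself. On diagonal blocks the second is contained in the first
and is not counted again. -/
lemma sum_phaseEffect_kronecker_apply (D : Matrix (a × b) (a × b) ℂ) (x x' : a × b) :
    (∑ z, phaseEffect z ⊗ₖ contract (phase z) D) x x' =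
      if x.1 = x'.1 then ∑ k, D (k, x.2) (k, x'.2) else D x x' := by
  have h3 : ((3 : ℂ) ^ Fintype.card a) ≠ 0 := by positivity
  simp only [Matrix.sum_apply, Matrix.kroneckerMap_apply, contract_apply, phaseEffect,
    Matrix.smul_apply, Matrix.vecMulVec_apply, Pi.star_apply, smul_eq_mul, Finset.mul_sum]
  rw [Finset.sum_comm]
  simp_rw [Finset.sum_comm (s := (Finset.univ : Finset (a → ZMod 3)))]
  have : ∀ k l, ∑ z, ((3 : ℂ) ^ Fintype.card a)⁻¹ * (phase z x.1 * star (phase z x'.1)) *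
      (star (phase z k) * phase z l * D (k, x.2) (l, x'.2)) =
      if (x.1 = x'.1 ∧ k = l) ∨ (x.1 = k ∧ x'.1 = l) then D (k, x.2) (l, x'.2) else 0 := by
    intro k l
    have e : ∀ z, ((3 : ℂ) ^ Fintype.card a)⁻¹ * (phase z x.1 * star (phase z x'.1)) *
      (star (phase z k) * phase z l * D (k, x.2) (l, x'.2)) =
      ((3 : ℂ) ^ Fintype.card a)⁻¹ * D (k, x.2) (l, x'.2) *
        (phase z x.1 * star (phase z x'.1) * (star (phase z k) * phase z l)) := fun z => by ring
    simp only [e, ← Finset.mul_sum, sum_phase]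
    split_ifs
    · field_simp
    · simp
  simp only [this]
  by_cases h : x.1 = x'.1
  · rw [if_pos h]
    refine Finset.sum_congr rfl fun k _ => ?_
    rw [Finset.sum_eq_single k]
    · simp [h]
    · intro l _ hl
      rw [if_neg]
      rintro (⟨_, h'⟩ | ⟨h', h''⟩)
      · exact hl h'.symm
      · exact hl (h''.symm.trans (h.symm.trans h'))
    · simp
  · rw [if_neg h, Finset.sum_eq_single x.1, Finset.sum_eq_single x'.1]
    · simp
    · intro l _ hl; simp [h, Ne.symm hl]
    · simp
    · intro k _ hk
      refine Finset.sum_eq_zero fun l _ => ?_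
      simp [h, Ne.symm hk]
    · simp

/-- The measurement in the standard basis. -/
def basisEffect (i : a) : Matrix a a ℂ := Matrix.single i i 1

lemma basisEffect_mem_ALL : ALL a a basisEffect := by
  refine ⟨fun i => ?_, ?_⟩
  · rw [basisEffect, ← Matrix.diagonal_single]
    refine Matrix.PosSemidef.diagonal fun j => ?_
    by_cases h : j = i
    · subst h; simp
    · simp [h]
  · ext x y
    simp only [basisEffect, Matrix.sum_apply, Matrix.single_apply, Matrix.one_apply]
    by_cases h : x = y
    · subst h; simp
    · simp [h]

lemma sum_basisEffect_kronecker_apply (D : Matrix (a × b) (a × b) ℂ) (x x' : a × b) :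
    (∑ i, basisEffect i ⊗ₖ ∑ k ∈ Finset.univ.erase i, contract (Pi.single k 1) D) x x' =
      if x.1 = x'.1 then ∑ k ∈ Finset.univ.erase x.1, D (k, x.2) (k, x'.2) else 0 := by
  simp only [Matrix.sum_apply, Matrix.kroneckerMap_apply, contract_single_apply, basisEffect,
    Matrix.single_apply, ite_mul, one_mul, zero_mul]
  rw [Finset.sum_eq_single x.1]
  · simp
  · intro i _ hi; simp [hi]
  · simp

/-- Off the diagonal blocks the phase measurement already reproduces `D`. In the diagonal block `i`
it leaves the sum of all diagonal blocks, and the basis measurement removes those with `k ≠ i`. -/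
lemma eq_sum_phaseEffect_sub (D : Matrix (a × b) (a × b) ℂ) :
    D = (∑ z, phaseEffect z ⊗ₖ contract (phase z) D) -
      ∑ i, basisEffect i ⊗ₖ ∑ k ∈ Finset.univ.erase i, contract (Pi.single k 1) D := by
  ext x x'
  rw [Matrix.sub_apply, sum_phaseEffect_kronecker_apply, sum_basisEffect_kronecker_apply]
  split_ifs with h
  · rw [← Finset.add_sum_erase _ _ (Finset.mem_univ x.1), add_sub_cancel_right, Prod.mk.eta, h,
      Prod.mk.eta]
  · simp

/-- Normalising the second party's maps to be unital costs n for the phases (a phase vector has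
squared norm n) and n - 1 for the basis (the number of `k ≠ i`). The minus sign of the second sum is
harmless because answers may be exchanged. -/
theorem Perfect.errorProb_LOCCAtoB_le [Nonempty a] {ρ σ : Matrix (a × b) (a × b) ℂ} {p : ℝ}
    (h : Perfect ρ σ p) : errorProb (LOCCAtoB a b) ρ σ p ≤
      1 / 2 * (1 - 1 / (2 * (Fintype.card a : ℝ) - 1)) := by
  have hn : (1 : ℝ) ≤ Fintype.card a := by exact_mod_cast Fintype.card_pos
  refine h.errorProb_le_of_forall (by linarith) fun P hP hP' => ?_
  set D := (2 : ℂ) • P - 1 with hD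
  have hc : (Fintype.card a : ℂ) ≠ 0 := by exact_mod_cast Fintype.card_ne_zero
  have b1 := abs_trace_le_of_unital h phaseEffect_mem_ALL
    (fun z => (Fintype.card a : ℂ)⁻¹ • contract (phase z))
    (fun z => by
      rw [LinearMap.smul_apply, contract_one]
      simp only [star_phase_mul_self, Finset.sum_const, Finset.card_univ, nsmul_eq_mul, mul_one]
      rw [smul_smul, inv_mul_cancel₀ hc, one_smul])
    (fun z X hX => by
      rw [LinearMap.smul_apply]; exact (contract_posSemidef _ hX).smul (by positivity)) hP hP'
  simp only [LinearMap.smul_apply, Matrix.kronecker_smul, ← Finset.smul_sum, Matrix.smul_mul,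
    Matrix.trace_smul, smul_eq_mul] at b1
  rw [← hD, ← Complex.ofReal_natCast, ← Complex.ofReal_inv, Complex.re_ofReal_mul] at b1
  have b1' := (le_abs_self _).trans b1
  rw [inv_mul_le_iff₀ (by linarith)] at b1'
  have b2 : -(((∑ i, basisEffect i ⊗ₖ ∑ k ∈ Finset.univ.erase i, contract (Pi.single k 1) D) *
      weighted ρ σ p).trace.re) ≤
      ((Fintype.card a : ℝ) - 1) * (1 - 2 * errorProb (LOCCAtoB a b) ρ σ p) := by
    have hcard : ∀ i : a, (Finset.univ.erase i).card = Fintype.card a - 1 := fun i => by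
      rw [Finset.card_erase_of_mem (Finset.mem_univ i), Finset.card_univ]
    -- For n = 1 the second sum is empty and cannot be normalised.
    by_cases h1 : Fintype.card a = 1
    · have : ∀ i : a, Finset.univ.erase i = ∅ := fun i => by
        rw [← Finset.card_eq_zero, hcard, h1]
      simp [this, h1]
    · have h2 : 2 ≤ Fintype.card a := by have := Fintype.card_pos (α := a); omega
      have h2' : (2 : ℝ) ≤ Fintype.card a := by exact_mod_cast h2
      have hc1 : ((Fintype.card a - 1 : ℕ) : ℂ) ≠ 0 := by
        exact_mod_cast (by omega : Fintype.card a - 1 ≠ 0)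
      have b2 := abs_trace_le_of_unital h basisEffect_mem_ALL
        (fun i => ((Fintype.card a - 1 : ℕ) : ℂ)⁻¹ •
          ∑ k ∈ Finset.univ.erase i, contract (Pi.single k 1))
        (fun i => by
          have : ∀ k : a, ∑ l, star ((Pi.single k 1 : a → ℂ) l) * (Pi.single k 1 : a → ℂ) l = 1 := by
            intro k
            rw [Finset.sum_eq_single k] <;> simp +contextual
          simp only [LinearMap.smul_apply, LinearMap.sum_apply, contract_one, this, one_smul,
            Finset.sum_const, hcard]
          rw [← Nat.cast_smul_eq_nsmul ℂ, smul_smul, inv_mul_cancel₀ hc1, one_smul])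
        (fun i X hX => by
          rw [LinearMap.smul_apply, LinearMap.sum_apply]
          exact (Matrix.posSemidef_sum _ fun k _ => contract_posSemidef _ hX).smul
            (by positivity)) hP hP'
      simp only [LinearMap.smul_apply, LinearMap.sum_apply, Matrix.kronecker_smul,
        ← Finset.smul_sum, Matrix.smul_mul, Matrix.trace_smul, smul_eq_mul] at b2
      rw [← hD, ← Complex.ofReal_natCast, ← Complex.ofReal_inv, Complex.re_ofReal_mul] at b2
      have b2' := (neg_le_abs _).trans b2
      rw [Nat.cast_sub (by omega), Nat.cast_one, ← mul_neg, inv_mul_le_iff₀ (by linarith)] at b2'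
      exact b2'
  have hDe := congrArg (fun Y => (Y * weighted ρ σ p).trace.re) (eq_sum_phaseEffect_sub D)
  simp only [Matrix.sub_mul, Matrix.trace_sub, Complex.sub_re] at hDe
  rw [hDe]
  linarith

/-! Exchanging the parties -/

lemma trace_reindex {d d' : Type} [Fintype d] [Fintype d'] (e : d ≃ d')
    (A B : Matrix d d ℂ) :
    (Matrix.reindex e e A * Matrix.reindex e e B).trace = (A * B).trace := by
  simp only [Matrix.reindex_apply, Matrix.submatrix_mul_equiv]
  simp only [Matrix.trace, Matrix.diag_apply, Matrix.submatrix_apply]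
  exact Equiv.sum_comp e.symm fun i => (A * B) i i

lemma errorProb_reindex {d d' : Type} [Fintype d] [Fintype d'] (e : d ≃ d')
    {M : MeasurementClass d} {M' : MeasurementClass d'}
    (h : ∀ (I : Type) [Fintype I] (E : I → Matrix d d ℂ),
      M' I (fun i => Matrix.reindex e e (E i)) ↔ M I E) (ρ σ : Matrix d d ℂ) (p : ℝ) :
    errorProb M' (Matrix.reindex e e ρ) (Matrix.reindex e e σ) p = errorProb M ρ σ p := by
  unfold errorProb
  congr 1
  ext ε
  constructor
  · rintro ⟨I, _, E, q, hE, hq, rfl⟩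
    obtain ⟨E, rfl⟩ : ∃ E' : I → Matrix d d ℂ, E = fun i => Matrix.reindex e e (E' i) :=
      ⟨fun i => (Matrix.reindex e e).symm (E i), by simp⟩
    exact ⟨I, _, E, q, (h I E).mp hE, hq, by simp only [trace_reindex]⟩
  · rintro ⟨I, _, E, q, hE, hq, rfl⟩
    exact ⟨I, _, _, q, (h I E).mpr hE, hq, by simp only [trace_reindex]⟩

lemma ALL_reindex {d d' : Type} [Fintype d] [Fintype d'] [DecidableEq d] [DecidableEq d']
    (e : d ≃ d') (I : Type) [Fintype I] (E : I → Matrix d d ℂ) :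
    ALL d' I (fun i => Matrix.reindex e e (E i)) ↔ ALL d I E := by
  have h1 : ∑ i, Matrix.reindex e e (E i) = (Matrix.reindex e e) (∑ i, E i) := by
    ext x y; simp [Matrix.sum_apply]
  have h2 : (Matrix.reindex e e) (1 : Matrix d d ℂ) = 1 := by simp
  have h3 : ∀ i, (Matrix.reindex e e (E i)).PosSemidef ↔ (E i).PosSemidef := fun i =>
    Matrix.posSemidef_submatrix_equiv _
  simp only [ALL, h1, h3]
  rw [← h2, (Matrix.reindex e e).apply_eq_iff_eq]

lemma IsState.reindex {d d' : Type} [Fintype d] [Fintype d'] [DecidableEq d]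
    (e : d ≃ d') {ρ : Matrix d d ℂ} (h : IsState ρ) : IsState (Matrix.reindex e e ρ) := by
  classical
  refine ⟨h.1.submatrix _, ?_⟩
  have := trace_reindex e 1 ρ
  rw [one_mul, h.2] at this
  simpa using this

lemma Perfect.reindex {d d' : Type} [Fintype d] [Fintype d'] [DecidableEq d] [DecidableEq d']
    (e : d ≃ d') {ρ σ : Matrix d d ℂ} {p : ℝ} (h : Perfect ρ σ p) :
    Perfect (Matrix.reindex e e ρ) (Matrix.reindex e e σ) p :=
  ⟨h.left.reindex e, h.right.reindex e, h.nonneg, h.le_one,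
    (errorProb_reindex e (ALL_reindex e) ρ σ p).trans h.error⟩

lemma LOCCAtoB_reindex (K : Type) [Fintype K] (M : K → Matrix (a × b) (a × b) ℂ) :
    LOCCAtoB b a K (fun k => Matrix.reindex (Equiv.prodComm a b) (Equiv.prodComm a b) (M k)) ↔
      LOCCBtoA a b K M := by
  have key : ∀ (I J : Type) [Fintype I] [Fintype J] (F : I → Matrix b b ℂ)
      (E : I → J → Matrix a a ℂ) (g : I × J → K) (k : K),
      Matrix.reindex (Equiv.prodComm a b) (Equiv.prodComm a b)
        (coarse g (fun x => E x.1 x.2 ⊗ₖ F x.1) k) = coarse g (fun x => F x.1 ⊗ₖ E x.1 x.2) k := by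
    intro I J _ _ F E g k
    ext x y
    simp [coarse, Matrix.sum_apply, Matrix.kroneckerMap_apply, mul_comm]
  constructor
  · rintro ⟨I, J, _, _, F, E, g, hF, hE, h⟩
    refine ⟨I, J, _, _, F, E, g, hF, hE, ?_⟩
    funext k
    exact (Matrix.reindex _ _).injective ((congrFun h k).trans (key I J F E g k).symm)
  · rintro ⟨I, J, _, _, F, E, g, hF, hE, rfl⟩
    exact ⟨I, J, _, _, F, E, g, hF, hE, funext fun k => key I J F E g k⟩

theorem Perfect.errorProb_LOCCBtoA_le [Nonempty b] {ρ σ : Matrix (a × b) (a × b) ℂ} {p : ℝ}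
    (h : Perfect ρ σ p) : errorProb (LOCCBtoA a b) ρ σ p ≤
      1 / 2 * (1 - 1 / (2 * (Fintype.card b : ℝ) - 1)) := by
  rw [← errorProb_reindex (Equiv.prodComm a b) LOCCAtoB_reindex]
  exact (h.reindex _).errorProb_LOCCAtoB_le

end

/-- The order on ℂ makes the quadratic form real, and over ℂ a real quadratic form forces the matrix
to be Hermitian. -/
lemma posSemidef_of_forall_nonneg {d : Type} [Fintype d] {A : Matrix d d ℂ}
    (h : ∀ v : d → ℂ, 0 ≤ star v ⬝ᵥ (A.mulVec v)) : A.PosSemidef := by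
  classical
  refine Matrix.PosSemidef.of_dotProduct_mulVec_nonneg ?_ h
  rw [← Matrix.isSymmetric_toEuclideanLin_iff, LinearMap.isSymmetric_iff_inner_map_self_real]
  intro v
  have := Complex.nonneg_iff.mp (h v.ofLp)
  rw [Complex.conj_eq_iff_im]
  have e : inner ℂ (Matrix.toEuclideanLin A v) v = star (star v.ofLp ⬝ᵥ (A.mulVec v.ofLp)) := by
    rw [EuclideanSpace.inner_eq_star_dotProduct, ← Matrix.star_dotProduct, dotProduct_comm]
    rfl
  rw [e]
  simp [← this.2]

section

variable {a b : Type} [Fintype a] [Fintype b]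

/-! Separable operators -/

lemma IsSeparable.kronecker {P : Matrix a a ℂ} {Q : Matrix b b ℂ} (hP : P.PosSemidef)
    (hQ : Q.PosSemidef) : IsSeparable (P ⊗ₖ Q) :=
  ⟨Unit, inferInstance, fun _ => P, fun _ => Q, fun _ => hP, fun _ => hQ, by simp⟩

lemma IsSeparable.sum {I : Type} (s : Finset I) {W : I → Matrix (a × b) (a × b) ℂ}
    (h : ∀ i ∈ s, IsSeparable (W i)) : IsSeparable (∑ i ∈ s, W i) := by
  have h' : ∀ i : s, IsSeparable (W i) := fun i => h i i.2
  choose K hK P Q hP hQ hW using h'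
  refine ⟨Σ i : s, K i, inferInstance, fun x => P x.1 x.2, fun x => Q x.1 x.2, fun x => hP _ _,
    fun x => hQ _ _, ?_⟩
  rw [Fintype.sum_sigma, ← Finset.sum_coe_sort]
  exact Finset.sum_congr rfl fun i _ => hW i

lemma IsSeparable.add {W W' : Matrix (a × b) (a × b) ℂ} (h : IsSeparable W)
    (h' : IsSeparable W') : IsSeparable (W + W') := by
  have := IsSeparable.sum Finset.univ (W := fun i : Bool => if i then W else W')
    (by rintro (_ | _) _ <;> simpa)
  simpa using this

lemma IsSeparable.smul {W : Matrix (a × b) (a × b) ℂ} (h : IsSeparable W) {c : ℂ} (hc : 0 ≤ c) :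
    IsSeparable (c • W) := by
  obtain ⟨K, _, P, Q, hP, hQ, rfl⟩ := h
  refine ⟨K, inferInstance, fun k => c • P k, Q, fun k => (hP k).smul hc, hQ, ?_⟩
  simp [Finset.smul_sum, Matrix.smul_kronecker]

lemma IsSeparable.one [DecidableEq a] [DecidableEq b] :
    IsSeparable (1 : Matrix (a × b) (a × b) ℂ) := by
  rw [← Matrix.one_kronecker_one]
  exact IsSeparable.kronecker Matrix.PosSemidef.one Matrix.PosSemidef.one

lemma IsSeparable.posSemidef {W : Matrix (a × b) (a × b) ℂ} (h : IsSeparable W) :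
    W.PosSemidef := by
  classical
  obtain ⟨K, _, P, Q, hP, hQ, rfl⟩ := h
  exact Matrix.posSemidef_sum _ fun k _ => (hP k).kronecker (hQ k)

lemma SEP_le_ALL [DecidableEq a] [DecidableEq b] (I : Type) [Fintype I]
    (E : I → Matrix (a × b) (a × b) ℂ) (hE : SEP a b I E) : ALL (a × b) I E := hE.1

/-! Adjoints of superoperators -/

/-- The image of `P` under the adjoint of `φ`. -/
def dual [DecidableEq a] (φ : SuperOp a) (P : Matrix a a ℂ) : Matrix a a ℂ :=
  Matrix.of fun x y => (P * φ (Matrix.single y x 1)).trace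

lemma trace_mul_eq_dual [DecidableEq a] (φ : SuperOp a) (P Z : Matrix a a ℂ) :
    (P * φ Z).trace = (dual φ P * Z).trace := by
  nth_rewrite 1 [Matrix.matrix_eq_sum_single Z]
  have : ∀ i j, Matrix.single i j (Z i j) = Z i j • Matrix.single i j (1 : ℂ) := by
    intro i j; rw [Matrix.smul_single, smul_eq_mul, mul_one]
  simp only [map_sum, this, map_smul, Finset.mul_sum, Matrix.trace_sum, Matrix.mul_smul,
    Matrix.trace_smul, smul_eq_mul]
  rw [Finset.sum_comm, Matrix.trace]
  refine Finset.sum_congr rfl fun j _ => ?_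
  rw [Matrix.diag_apply, Matrix.mul_apply]
  refine Finset.sum_congr rfl fun i _ => ?_
  rw [dual, Matrix.of_apply, mul_comm]

/-- The quadratic form of the dual at `v` is `Tr P φ(v v*)`, a trace of a product of two positive
operators. -/
lemma dual_posSemidef [DecidableEq a] {φ : SuperOp a}
    (hφ : ∀ Z : Matrix a a ℂ, Z.PosSemidef → (φ Z).PosSemidef)
    {P : Matrix a a ℂ} (hP : P.PosSemidef) : (dual φ P).PosSemidef := by
  refine posSemidef_of_forall_nonneg fun v => ?_
  rw [dotProduct_comm, ← Matrix.trace_vecMulVec, ← Matrix.mul_vecMulVec, ← trace_mul_eq_dual]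
  exact trace_mul_nonneg hP (hφ _ (Matrix.posSemidef_vecMulVec_self_star v))

lemma IsCP.posSemidef {φ : SuperOp a} (h : IsCP φ) {Z : Matrix a a ℂ} (hZ : Z.PosSemidef) :
    (φ Z).PosSemidef :=
  (h 1 (Z.submatrix Prod.fst Prod.fst) (hZ.submatrix _)).submatrix fun x => (x, 0)

lemma trace_kronecker_mul_left (P : Matrix a a ℂ) (Q : Matrix b b ℂ)
    (Z : Matrix (a × b) (a × b) ℂ) : ((P ⊗ₖ Q) * Z).trace =
      ∑ y, ∑ y', Q y y' * (P * Matrix.of fun i j => Z (i, y') (j, y)).trace := by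
  simp only [Matrix.trace, Matrix.diag_apply, Matrix.mul_apply, Fintype.sum_prod_type,
    Matrix.kroneckerMap_apply, Matrix.of_apply, Finset.mul_sum]
  rw [Finset.sum_comm]
  refine Finset.sum_congr rfl fun y _ => ?_
  simp_rw [Finset.sum_comm (s := (Finset.univ : Finset b))]
  refine Finset.sum_congr rfl fun x _ => Finset.sum_congr rfl fun x' _ =>
    Finset.sum_congr rfl fun y' _ => ?_
  ring

lemma trace_kronecker_mul_right (P : Matrix a a ℂ) (Q : Matrix b b ℂ)
    (Z : Matrix (a × b) (a × b) ℂ) : ((P ⊗ₖ Q) * Z).trace =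
      ∑ x, ∑ x', P x x' * (Q * Matrix.of fun i j => Z (x', i) (x, j)).trace := by
  simp only [Matrix.trace, Matrix.diag_apply, Matrix.mul_apply, Fintype.sum_prod_type,
    Matrix.kroneckerMap_apply, Matrix.of_apply, Finset.mul_sum]
  refine Finset.sum_congr rfl fun x _ => ?_
  rw [Finset.sum_comm]
  refine Finset.sum_congr rfl fun x' _ => Finset.sum_congr rfl fun y _ =>
    Finset.sum_congr rfl fun y' _ => ?_
  ring

/-- The two factors are treated one at a time: expanding over the blocks of the other party reduces
each to a one-party adjoint. -/
lemma trace_kronecker_mul_tensorMap {φ : SuperOp a} {ψ : SuperOp b} {P P' : Matrix a a ℂ}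
    {Q Q' : Matrix b b ℂ} (hφ : ∀ Z, (P * φ Z).trace = (P' * Z).trace)
    (hψ : ∀ Z, (Q * ψ Z).trace = (Q' * Z).trace) (X : Matrix (a × b) (a × b) ℂ) :
    ((P ⊗ₖ Q) * tensorMap φ ψ X).trace = ((P' ⊗ₖ Q') * X).trace := by
  have h1 : ∀ Y, ((P ⊗ₖ Q) * actLeft b φ Y).trace = ((P' ⊗ₖ Q) * Y).trace := fun Y => by
    rw [trace_kronecker_mul_left, trace_kronecker_mul_left]
    simp only [← hφ]
    rfl
  have h2 : ((P' ⊗ₖ Q) * actRight a ψ X).trace = ((P' ⊗ₖ Q') * X).trace := by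
    rw [trace_kronecker_mul_right, trace_kronecker_mul_right]
    simp only [← hψ]
    rfl
  exact (h1 _).trans h2

/-! LOCC instruments have separable adjoints -/

/-- Trace-preserving families of superoperators whose adjoints preserve separability. -/
structure IsSepInstrument {I : Type} [Fintype I] (Φ : I → SuperOp (a × b)) : Prop where
  adjoint : ∀ i W, IsSeparable W → ∃ W', IsSeparable W' ∧
    ∀ X, (W * Φ i X).trace = (W' * X).trace
  trace : ∀ X, ∑ i, (Φ i X).trace = X.trace

lemma exists_isSeparable_adjoint_tensorMap {φ : SuperOp a} {ψ : SuperOp b} (hφ : IsCP φ)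
    (hψ : IsCP ψ) {W : Matrix (a × b) (a × b) ℂ} (hW : IsSeparable W) :
    ∃ W', IsSeparable W' ∧ ∀ X, (W * tensorMap φ ψ X).trace = (W' * X).trace := by
  classical
  obtain ⟨K, _, P, Q, hP, hQ, rfl⟩ := hW
  refine ⟨∑ k, dual φ (P k) ⊗ₖ dual ψ (Q k), ⟨K, _, _, _,
    fun k => dual_posSemidef (fun _ => hφ.posSemidef) (hP k),
    fun k => dual_posSemidef (fun _ => hψ.posSemidef) (hQ k), rfl⟩, fun X => ?_⟩
  simp only [Finset.sum_mul, Matrix.trace_sum]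
  exact Finset.sum_congr rfl fun k _ => trace_kronecker_mul_tensorMap
    (trace_mul_eq_dual φ (P k)) (trace_mul_eq_dual ψ (Q k)) X

lemma trace_tensorMap [DecidableEq a] [DecidableEq b] (φ : SuperOp a) (ψ : SuperOp b)
    (X : Matrix (a × b) (a × b) ℂ) :
    (tensorMap φ ψ X).trace = ((dual φ 1 ⊗ₖ dual ψ 1) * X).trace := by
  rw [← trace_kronecker_mul_tensorMap (trace_mul_eq_dual φ 1) (trace_mul_eq_dual ψ 1),
    Matrix.one_kronecker_one, one_mul]

lemma IsInstrument.sum_dual_one [DecidableEq a] {I : Type} [Fintype I] {E : I → SuperOp a}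
    (h : IsInstrument E) : ∑ i, dual (E i) 1 = 1 := by
  ext x y
  have := h.2 (Matrix.single y x 1)
  simp only [dual, Matrix.sum_apply, Matrix.of_apply, one_mul, this, Matrix.one_apply]
  by_cases hxy : x = y
  · subst hxy; simp
  · simp [hxy, Matrix.trace_single_eq_of_ne _ _ _ (Ne.symm hxy)]

lemma IsChannel.dual_one [DecidableEq a] {φ : SuperOp a} (h : IsChannel φ) : dual φ 1 = 1 := by
  have : IsInstrument fun _ : Unit => φ := ⟨fun _ => h.1, fun X => by simpa using h.2 X⟩
  simpa using this.sum_dual_one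

lemma IsOneWayLocal.isSepInstrument {I : Type} [Fintype I] {Φ : I → SuperOp (a × b)}
    (h : IsOneWayLocal Φ) : IsSepInstrument Φ := by
  classical
  rcases h with ⟨E, T, hE, hT, hΦ⟩ | ⟨T, E, hT, hE, hΦ⟩
  · refine ⟨fun i W hW => ?_, fun X => ?_⟩
    · rw [hΦ]; exact exists_isSeparable_adjoint_tensorMap (hE.1 i) (hT i).1 hW
    · simp only [hΦ, trace_tensorMap, (hT _).dual_one]
      rw [← Matrix.trace_sum, ← Finset.sum_mul]
      have : ∑ i, dual (E i) 1 ⊗ₖ (1 : Matrix b b ℂ) = 1 := by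
        rw [sum_kronecker, hE.sum_dual_one, Matrix.one_kronecker_one]
      rw [this, one_mul]
  · refine ⟨fun i W hW => ?_, fun X => ?_⟩
    · rw [hΦ]; exact exists_isSeparable_adjoint_tensorMap (hT i).1 (hE.1 i) hW
    · simp only [hΦ, trace_tensorMap, (hT _).dual_one]
      rw [← Matrix.trace_sum, ← Finset.sum_mul]
      have : ∑ i, (1 : Matrix a a ℂ) ⊗ₖ dual (E i) 1 = 1 := by
        rw [kronecker_sum, hE.sum_dual_one, Matrix.one_kronecker_one]
      rw [this, one_mul]

lemma coarse_superOp_apply {d I K : Type} [Fintype I] (g : I → K)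
    (Φ : I → SuperOp d) (k : K) (X : Matrix d d ℂ) :
    coarse g Φ k X = coarse g (fun i => Φ i X) k := by
  simp [coarse, LinearMap.sum_apply]

lemma trace_coarse {d I K : Type} [Fintype d] [Fintype I] (g : I → K)
    (Z : I → Matrix d d ℂ) (k : K) :
    (coarse g Z k).trace = coarse g (fun i => (Z i).trace) k := by
  simp [coarse, Matrix.trace_sum]

lemma IsSepInstrument.coarse {I K : Type} [Fintype I] [Fintype K] {Φ : I → SuperOp (a × b)}
    (h : IsSepInstrument Φ) (g : I → K) : IsSepInstrument (coarse g Φ) := by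
  refine ⟨fun k W hW => ?_, fun X => ?_⟩
  · choose W' hW' hX using fun i => h.adjoint i W hW
    refine ⟨DataHiding.coarse g W' k, IsSeparable.sum _ fun i _ => hW' i, fun X => ?_⟩
    rw [coarse_superOp_apply]
    simp only [DataHiding.coarse, Finset.mul_sum, Finset.sum_mul, Matrix.trace_sum, hX]
  · simp only [coarse_superOp_apply, trace_coarse, sum_coarse]
    exact h.trace X

lemma IsSepInstrument.link {I K : Type} [Fintype I] [Fintype K] {Φ : I → SuperOp (a × b)}
    {Ψ : K → SuperOp (a × b)} (h : IsSepInstrument Φ) (hl : IsLinked Φ Ψ) :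
    IsSepInstrument Ψ := by
  obtain ⟨J, _, F, g, hF, rfl⟩ := hl
  refine IsSepInstrument.coarse ⟨fun x W hW => ?_, fun X => ?_⟩ g
  · obtain ⟨W1, hW1, hX1⟩ := (hF x.1).isSepInstrument.adjoint x.2 W hW
    obtain ⟨W2, hW2, hX2⟩ := h.adjoint x.1 W1 hW1
    exact ⟨W2, hW2, fun X => by rw [LinearMap.comp_apply, hX1, hX2]⟩
  · rw [Fintype.sum_sigma, ← h.trace X]
    exact Finset.sum_congr rfl fun i _ => (hF i).isSepInstrument.trace (Φ i X)

lemma IsFiniteLOCC.isSepInstrument {I : Type} [Fintype I] {Φ : I → SuperOp (a × b)}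
    (h : IsFiniteLOCC Φ) : IsSepInstrument Φ := by
  induction h with
  | one Φ g hΦ => exact hΦ.isSepInstrument.coarse g
  | link Φ Ψ _ hl ih => exact ih.link hl

/-- The effects are the adjoint images of the separable operator 1; preservation of the trace makes
them sum to 1. -/
lemma IsSepInstrument.exists_SEP [DecidableEq a] [DecidableEq b] {I : Type} [Fintype I]
    {Φ : I → SuperOp (a × b)} (h : IsSepInstrument Φ) :
    ∃ E, SEP a b I E ∧ ∀ i X, (E i * X).trace = (Φ i X).trace := by
  choose E hE hX using fun i => h.adjoint i 1 IsSeparable.one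
  simp only [one_mul] at hX
  refine ⟨E, ⟨⟨fun i => (hE i).posSemidef, ?_⟩, hE⟩, fun i X => (hX i X).symm⟩
  rw [Matrix.ext_iff_trace_mul_right]
  intro X
  rw [Finset.sum_mul, Matrix.trace_sum, one_mul, ← h.trace X]
  exact Finset.sum_congr rfl fun i _ => (hX i X).symm

/-- Each approximating instrument gives a separable measurement, and the inequality for its error
passes to the limit. Comparing errors rather than effects avoids showing that the separable cone is
closed. -/
lemma errorProb_SEP_le_of_LOCC [DecidableEq a] [DecidableEq b]
    {ρ σ : Matrix (a × b) (a × b) ℂ} {p : ℝ}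
    (hρ : IsState ρ) (hσ : IsState σ) (hp : 0 ≤ p) (hp1 : p ≤ 1)
    {I : Type} [Fintype I] {E : I → Matrix (a × b) (a × b) ℂ} (hE : LOCC a b I E)
    {q : I → ℝ} (hq : ∀ i, 0 ≤ q i ∧ q i ≤ 1) :
    errorProb (SEP a b) ρ σ p ≤
      p * ∑ i, (1 - q i) * (E i * ρ).trace.re + (1 - p) * ∑ i, q i * (E i * σ).trace.re := by
  obtain ⟨Φ, ⟨K, _, Ψ, g, hΨ, -, hlim⟩, hΦ⟩ := hE
  have ht : ∀ i X, Filter.Tendsto (fun ν => (coarse (g ν) (Ψ ν) i X).trace.re) Filter.atTop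
      (𝓝 (E i * X).trace.re) := fun i X => by
    rw [hΦ]
    exact ((Complex.continuous_re.comp (continuous_id.matrix_trace)).tendsto _).comp (hlim i X)
  refine ge_of_tendsto' (f := fun ν => p * ∑ i, (1 - q i) * (coarse (g ν) (Ψ ν) i ρ).trace.re
    + (1 - p) * ∑ i, q i * (coarse (g ν) (Ψ ν) i σ).trace.re) (x := Filter.atTop) ?_ fun ν => ?_
  · exact ((tendsto_finsetSum _ fun i _ => (ht i ρ).const_mul _).const_mul _).add
      ((tendsto_finsetSum _ fun i _ => (ht i σ).const_mul _).const_mul _)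
  · obtain ⟨E', hE', hX⟩ := ((hΨ ν).isSepInstrument.coarse (g ν)).exists_SEP
    simp only [← hX]
    exact errorProb_le SEP_le_ALL hρ hσ hp hp1 hE' hq

/-! One-way measurements are LOCC -/

/-- The superoperator `X ↦ B X Bᴴ`. -/
def conjOp (B : Matrix a a ℂ) : SuperOp a where
  toFun X := B * X * B.conjTranspose
  map_add' X Y := by rw [Matrix.mul_add, Matrix.add_mul]
  map_smul' c X := by simp

lemma isCP_conjOp (B : Matrix a a ℂ) : IsCP (conjOp B) := by
  intro k X hX
  have : actLeft (Fin k) (conjOp B) X =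
      (B ⊗ₖ (1 : Matrix (Fin k) (Fin k) ℂ)) * X * (B ⊗ₖ (1 : Matrix _ _ ℂ)).conjTranspose := by
    ext x y
    simp [actLeft, conjOp, Matrix.mul_apply, Matrix.kroneckerMap_apply, Fintype.sum_prod_type,
      Matrix.one_apply, apply_ite star]
  rw [this]
  exact hX.mul_mul_conjTranspose_same _

lemma isChannel_id : IsChannel (LinearMap.id : SuperOp a) :=
  ⟨fun _ _ hX => hX, fun _ => rfl⟩

/-- Write each effect as `Cᴴ C` and take the map `X ↦ C X Cᴴ`. -/
lemma exists_instrument_of_ALL [DecidableEq a] {I : Type} [Fintype I] {E : I → Matrix a a ℂ}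
    (hE : ALL a I E) : ∃ Φ : I → SuperOp a, IsInstrument Φ ∧
      ∀ i X, (Φ i X).trace = (E i * X).trace := by
  have : ∀ i, ∃ C : Matrix a a ℂ, E i = C.conjTranspose * C := fun i => by
    open scoped MatrixOrder in
    exact CStarAlgebra.nonneg_iff_eq_star_mul_self.mp (hE.1 i).nonneg
  choose C hC using this
  have h : ∀ i X, (conjOp (C i) X).trace = (E i * X).trace := fun i X => by
    rw [hC, Matrix.mul_assoc, Matrix.trace_mul_comm (C i).conjTranspose]; rfl
  refine ⟨fun i => conjOp (C i), ⟨fun i => isCP_conjOp _, fun X => ?_⟩, h⟩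
  simp only [h]
  rw [← Matrix.trace_sum, ← Finset.sum_mul, hE.2, one_mul]

/-- Doing nothing is a one-way local instrument, so a finite protocol can be continued as a constant
sequence. -/
lemma isLinked_self {K : Type} [Fintype K] (Ψ : K → SuperOp (a × b)) : IsLinked Ψ Ψ := by
  classical
  refine ⟨fun _ => Unit, fun _ => inferInstance, fun _ _ => tensorMap .id .id, Sigma.fst,
    fun _ => Or.inl ⟨fun _ => .id, fun _ => .id, ⟨fun _ => isChannel_id.1, fun X => by simp⟩,
      fun _ => isChannel_id, fun _ => rfl⟩, ?_⟩
  have : (tensorMap .id .id : SuperOp (a × b)) = .id := rfl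
  funext k
  simp [coarse, Finset.sum_filter, Fintype.sum_sigma, this]

lemma IsFiniteLOCC.isLOCCInstrument {K : Type} [Fintype K] {Ψ : K → SuperOp (a × b)}
    (h : IsFiniteLOCC Ψ) : IsLOCCInstrument Ψ := by
  classical
  refine ⟨fun _ => K, fun _ => inferInstance, fun _ => Ψ, fun _ => id, fun _ => h,
    fun _ => isLinked_self Ψ, fun i X => ?_⟩
  have : coarse id Ψ i = Ψ i := by simp [coarse, Finset.sum_filter]
  simp only [this]
  exact tendsto_const_nhds

/-- A one-way measurement takes two rounds: within one round the receiver only applies a channel, so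
the receiver's own measurement needs the next. -/
lemma mem_LOCC_of_two_rounds {I J K : Type} [Fintype I] [Fintype J] [Fintype K]
    {Φ : I → SuperOp (a × b)} (hΦ : IsOneWayLocal Φ) {F : I → J → SuperOp (a × b)}
    (hF : ∀ i, IsOneWayLocal (F i)) (g : I × J → K) (M : I × J → Matrix (a × b) (a × b) ℂ)
    (hM : ∀ i j X, (F i j (Φ i X)).trace = (M (i, j) * X).trace) :
    LOCC a b K (coarse g M) := by
  classical
  have h1 : IsFiniteLOCC Φ := by
    have := IsFiniteLOCC.one Φ id hΦ
    have e : coarse id Φ = Φ := by funext i; simp [coarse, Finset.sum_filter]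
    rwa [e] at this
  have h2 : IsFiniteLOCC (coarse (fun x : Σ _ : I, J => g (x.1, x.2))
      fun x => F x.1 x.2 ∘ₗ Φ x.1) :=
    h1.link _ _ ⟨fun _ => J, fun _ => inferInstance, F, _, hF, rfl⟩
  refine ⟨_, h2.isLOCCInstrument, fun k X => ?_⟩
  rw [coarse_superOp_apply, trace_coarse]
  simp only [coarse, Finset.sum_filter, Fintype.sum_sigma, Fintype.sum_prod_type, Finset.sum_mul,
    Matrix.trace_sum, LinearMap.comp_apply, hM, ite_mul, zero_mul, apply_ite Matrix.trace,
    Matrix.trace_zero]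

section

variable [DecidableEq a] [DecidableEq b]

lemma trace_tensorMap_id_left {ψ : SuperOp b} {Q : Matrix b b ℂ}
    (hψ : ∀ Z, (ψ Z).trace = (Q * Z).trace) (X : Matrix (a × b) (a × b) ℂ) :
    (tensorMap .id ψ X).trace = (((1 : Matrix a a ℂ) ⊗ₖ Q) * X).trace := by
  rw [← trace_kronecker_mul_tensorMap (φ := .id) (ψ := ψ) (P := 1) (Q := 1)
    (fun Z => by rw [LinearMap.id_apply]) (fun Z => by rw [one_mul, hψ]),
    Matrix.one_kronecker_one, one_mul]

lemma trace_tensorMap_id_right {φ : SuperOp a} {P : Matrix a a ℂ}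
    (hφ : ∀ Z, (φ Z).trace = (P * Z).trace) (X : Matrix (a × b) (a × b) ℂ) :
    (tensorMap φ .id X).trace = ((P ⊗ₖ (1 : Matrix b b ℂ)) * X).trace := by
  rw [← trace_kronecker_mul_tensorMap (φ := φ) (ψ := .id) (P := 1) (Q := 1)
    (fun Z => by rw [one_mul, hφ]) (fun Z => by rw [LinearMap.id_apply]),
    Matrix.one_kronecker_one, one_mul]

lemma LOCCAtoB_le_LOCC (K : Type) [Fintype K] (M : K → Matrix (a × b) (a × b) ℂ)
    (hM : LOCCAtoB a b K M) : LOCC a b K M := by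
  obtain ⟨I, J, _, _, E, F, g, hE, hF, rfl⟩ := hM
  obtain ⟨Φ, hΦ, hΦt⟩ := exists_instrument_of_ALL hE
  choose Ψ hΨ hΨt using fun i => exists_instrument_of_ALL (hF i)
  have h1 : IsOneWayLocal fun i => tensorMap (Φ i) (.id : SuperOp b) :=
    Or.inl ⟨Φ, fun _ => .id, hΦ, fun _ => isChannel_id, fun _ => rfl⟩
  have h2 : ∀ i, IsOneWayLocal fun j => tensorMap (.id : SuperOp a) (Ψ i j) := fun i =>
    Or.inr ⟨fun _ => .id, Ψ i, fun _ => isChannel_id, hΨ i, fun _ => rfl⟩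
  refine mem_LOCC_of_two_rounds h1 h2 g (fun x => E x.1 ⊗ₖ F x.1 x.2) fun i j X => ?_
  rw [trace_tensorMap_id_left (hΨt i j)]
  exact trace_kronecker_mul_tensorMap (fun Z => by rw [one_mul, hΦt])
    (fun Z => by rw [LinearMap.id_apply]) X

lemma LOCCBtoA_le_LOCC (K : Type) [Fintype K] (M : K → Matrix (a × b) (a × b) ℂ)
    (hM : LOCCBtoA a b K M) : LOCC a b K M := by
  obtain ⟨I, J, _, _, F, E, g, hF, hE, rfl⟩ := hM
  obtain ⟨Φ, hΦ, hΦt⟩ := exists_instrument_of_ALL hF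
  choose Ψ hΨ hΨt using fun i => exists_instrument_of_ALL (hE i)
  have h1 : IsOneWayLocal fun i => tensorMap (.id : SuperOp a) (Φ i) :=
    Or.inr ⟨fun _ => .id, Φ, fun _ => isChannel_id, hΦ, fun _ => rfl⟩
  have h2 : ∀ i, IsOneWayLocal fun j => tensorMap (Ψ i j) (.id : SuperOp b) := fun i =>
    Or.inl ⟨Ψ i, fun _ => .id, hΨ i, fun _ => isChannel_id, fun _ => rfl⟩
  refine mem_LOCC_of_two_rounds h1 h2 g (fun x => E x.1 x.2 ⊗ₖ F x.1) fun i j X => ?_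
  rw [trace_tensorMap_id_right (hΨt i j)]
  exact trace_kronecker_mul_tensorMap (fun Z => by rw [LinearMap.id_apply])
    (fun Z => by rw [one_mul, hΦt]) X

/-! ### Comparison of the error probabilities of the classes -/

variable {ρ σ : Matrix (a × b) (a × b) ℂ} {p : ℝ}

lemma exists_mem_LOCCAtoB : ∃ (I : Type) (_ : Fintype I) (E : I → Matrix (a × b) (a × b) ℂ),
    LOCCAtoB a b I E :=
  ⟨Unit, inferInstance, _, Unit, Unit, inferInstance, inferInstance, fun _ => 1, fun _ _ => 1,
    fun _ => (), ⟨fun _ => Matrix.PosSemidef.one, by simp⟩,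
    fun _ => ⟨fun _ => Matrix.PosSemidef.one, by simp⟩, rfl⟩

lemma exists_mem_LOCCBtoA : ∃ (I : Type) (_ : Fintype I) (E : I → Matrix (a × b) (a × b) ℂ),
    LOCCBtoA a b I E :=
  ⟨Unit, inferInstance, _, Unit, Unit, inferInstance, inferInstance, fun _ => 1, fun _ _ => 1,
    fun _ => (), ⟨fun _ => Matrix.PosSemidef.one, by simp⟩,
    fun _ => ⟨fun _ => Matrix.PosSemidef.one, by simp⟩, rfl⟩

lemma Perfect.errorProb_SEP_le_LOCC (h : Perfect ρ σ p) :
    errorProb (SEP a b) ρ σ p ≤ errorProb (LOCC a b) ρ σ p := by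
  obtain ⟨I, _, E, hE⟩ := exists_mem_LOCCAtoB (a := a) (b := b)
  exact le_errorProb ⟨I, _, E, LOCCAtoB_le_LOCC I E hE⟩ fun I _ E q hE hq =>
    errorProb_SEP_le_of_LOCC h.left h.right h.nonneg h.le_one hE hq

lemma Perfect.errorProb_LOCC_le_of_subclass (h : Perfect ρ σ p) {M : MeasurementClass (a × b)}
    (hM : ∀ (K : Type) [Fintype K] (E : K → Matrix (a × b) (a × b) ℂ), M K E → LOCC a b K E)
    (hne : ∃ (I : Type) (_ : Fintype I) (E : I → Matrix (a × b) (a × b) ℂ), M I E) :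
    errorProb (LOCC a b) ρ σ p ≤ errorProb M ρ σ p := by
  -- The infimum over LOCC must be bounded below; the separable error probability serves.
  refine le_errorProb hne fun I _ E q hE hq => csInf_le ⟨errorProb (SEP a b) ρ σ p, ?_⟩
    ⟨I, _, E, q, hM I E hE, hq, rfl⟩
  rintro _ ⟨J, _, E', q', hE', hq', rfl⟩
  exact errorProb_SEP_le_of_LOCC h.left h.right h.nonneg h.le_one hE' hq'

end

end

/-! Werner states -/

/-- The flip operator. -/
def flip (m : Type) [DecidableEq m] : Matrix (m × m) (m × m) ℂ :=
  (1 : Matrix (m × m) (m × m) ℂ).submatrix Prod.swap id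

section

variable {m a b : Type} [Fintype m] [DecidableEq m] [Fintype a] [Fintype b] [DecidableEq a]
  [DecidableEq b]

lemma flip_mul_apply (Y : Matrix (m × m) (m × m) ℂ) (x y : m × m) :
    (flip m * Y) x y = Y x.swap y := by
  simp [flip, Matrix.mul_apply, Matrix.one_apply]

lemma flip_mul_self : flip m * flip m = 1 := by
  ext x y
  rw [flip_mul_apply, flip, Matrix.submatrix_apply, Prod.swap_swap, id]

lemma flip_conjTranspose : (flip m).conjTranspose = flip m := by
  ext x y
  simp only [flip, Matrix.conjTranspose_apply, Matrix.submatrix_apply, id, Matrix.one_apply,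
    apply_ite star, star_one, star_zero]
  congr 1
  rw [Prod.swap_eq_iff_eq_swap, eq_comm (a := y)]

lemma trace_mul_flip (Y : Matrix (m × m) (m × m) ℂ) :
    (Y * flip m).trace = ∑ i, ∑ j, Y (i, j) (j, i) := by
  rw [Matrix.trace_mul_comm, Matrix.trace, Fintype.sum_prod_type, Finset.sum_comm]
  simp [flip_mul_apply]

lemma trace_flip : (flip m).trace = Fintype.card m := by
  rw [← one_mul (flip m), trace_mul_flip]
  simp [Matrix.one_apply, Prod.mk.injEq, ite_and]

/-- The projection onto the symmetric subspace. -/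
def symProj (m : Type) [DecidableEq m] : Matrix (m × m) (m × m) ℂ := (1 / 2 : ℂ) • (1 + flip m)

/-- The projection onto the antisymmetric subspace. -/
def asymProj (m : Type) [DecidableEq m] : Matrix (m × m) (m × m) ℂ := (1 / 2 : ℂ) • (1 - flip m)

lemma symProj_sub_asymProj : symProj m - asymProj m = flip m := by
  rw [symProj, asymProj, ← smul_sub, add_sub_sub_cancel, ← two_smul ℂ (flip m), smul_smul]
  norm_num

lemma symProj_mul_self : symProj m * symProj m = symProj m := by
  simp only [symProj, Matrix.smul_mul, Matrix.mul_smul, mul_add, add_mul, one_mul, mul_one,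
    flip_mul_self]
  module

lemma asymProj_mul_self : asymProj m * asymProj m = asymProj m := by
  simp only [asymProj, Matrix.smul_mul, Matrix.mul_smul, mul_sub, sub_mul, one_mul, mul_one,
    flip_mul_self]
  module

lemma symProj_mul_flip : symProj m * flip m = symProj m := by
  simp only [symProj, Matrix.smul_mul, add_mul, one_mul, flip_mul_self]
  rw [add_comm]

lemma symProj_conjTranspose : (symProj m).conjTranspose = symProj m := by
  simp [symProj, flip_conjTranspose]

lemma asymProj_conjTranspose : (asymProj m).conjTranspose = asymProj m := by
  simp [asymProj, flip_conjTranspose]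

lemma posSemidef_of_projection {d : Type} [Fintype d] {P : Matrix d d ℂ}
    (h1 : P.conjTranspose = P) (h2 : P * P = P) : P.PosSemidef := by
  have := Matrix.posSemidef_conjTranspose_mul_self P
  rwa [h1, h2] at this

lemma trace_symProj : (symProj m).trace =
    ((Fintype.card m * (Fintype.card m + 1) / 2 : ℝ) : ℂ) := by
  simp [symProj, Matrix.trace_smul, Matrix.trace_add, trace_flip, Matrix.trace_one]
  ring

lemma trace_asymProj : (asymProj m).trace =
    ((Fintype.card m * (Fintype.card m - 1) / 2 : ℝ) : ℂ) := by
  simp [asymProj, Matrix.trace_smul, Matrix.trace_sub, trace_flip, Matrix.trace_one]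
  ring

/-- The isometry of `ℂ^m ⊗ ℂ^m` into the bipartite system given by maps of the bases. -/
def embed (f : m → a) (g : m → b) : Matrix (a × b) (m × m) ℂ :=
  (1 : Matrix (a × b) (a × b) ℂ).submatrix id (Prod.map f g)

lemma embed_conj (f : m → a) (g : m → b) (E : Matrix (a × b) (a × b) ℂ) :
    (embed f g).conjTranspose * E * embed f g = E.submatrix (Prod.map f g) (Prod.map f g) := by
  ext x y
  simp only [embed, Matrix.mul_apply, Matrix.conjTranspose_apply, Matrix.submatrix_apply, id,
    Matrix.one_apply, apply_ite star, star_one, star_zero, ite_mul, one_mul, zero_mul, mul_ite,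
    mul_one, mul_zero, Finset.sum_ite_eq', Finset.mem_univ, if_true]

variable {f : m → a} {g : m → b}

lemma embed_isometry (hf : f.Injective) (hg : g.Injective) :
    (embed f g).conjTranspose * embed f g = 1 := by
  have := embed_conj f g 1
  rwa [Matrix.mul_one, Matrix.submatrix_one _ (hf.prodMap hg)] at this

/-- Embedding an operator on `ℂ^m ⊗ ℂ^m`. -/
def lift (f : m → a) (g : m → b) (Y : Matrix (m × m) (m × m) ℂ) : Matrix (a × b) (a × b) ℂ :=
  embed f g * Y * (embed f g).conjTranspose

lemma trace_mul_lift (E : Matrix (a × b) (a × b) ℂ) (Y : Matrix (m × m) (m × m) ℂ) :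
    (E * lift f g Y).trace = (E.submatrix (Prod.map f g) (Prod.map f g) * Y).trace := by
  rw [lift, ← embed_conj, Matrix.mul_assoc (embed f g), ← Matrix.mul_assoc, ← Matrix.mul_assoc,
    Matrix.trace_mul_comm, ← Matrix.mul_assoc, ← Matrix.mul_assoc]

lemma trace_lift (hf : f.Injective) (hg : g.Injective) (Y : Matrix (m × m) (m × m) ℂ) :
    (lift f g Y).trace = Y.trace := by
  rw [← one_mul (lift f g Y), trace_mul_lift, Matrix.submatrix_one _ (hf.prodMap hg), one_mul]

lemma lift_mul_lift (hf : f.Injective) (hg : g.Injective) (Y Z : Matrix (m × m) (m × m) ℂ) :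
    lift f g Y * lift f g Z = lift f g (Y * Z) := by
  calc lift f g Y * lift f g Z
      = embed f g * Y * ((embed f g).conjTranspose * embed f g) * Z *
          (embed f g).conjTranspose := by simp only [lift, Matrix.mul_assoc]
    _ = _ := by rw [embed_isometry hf hg, Matrix.mul_one, lift, Matrix.mul_assoc (embed f g)]

lemma lift_sub (Y Z : Matrix (m × m) (m × m) ℂ) :
    lift f g (Y - Z) = lift f g Y - lift f g Z := by
  rw [lift, Matrix.mul_sub, Matrix.sub_mul]; rfl

lemma lift_conjTranspose (Y : Matrix (m × m) (m × m) ℂ) :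
    (lift f g Y).conjTranspose = lift f g Y.conjTranspose := by
  simp [lift, Matrix.conjTranspose_mul, Matrix.mul_assoc]

/-- On a product `P ⊗ Q` the flip gives `Tr P'Q'` with `P'`, `Q'` the compressions of `P`, `Q` to
the selected basis vectors. -/
lemma IsSeparable.trace_mul_lift_flip_nonneg {W : Matrix (a × b) (a × b) ℂ} (h : IsSeparable W) :
    0 ≤ (W * lift f g (flip m)).trace.re := by
  obtain ⟨K, _, P, Q, hP, hQ, rfl⟩ := h
  rw [Finset.sum_mul, Matrix.trace_sum, Complex.re_sum]
  refine Finset.sum_nonneg fun k _ => ?_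
  have : ((P k ⊗ₖ Q k) * lift f g (flip m)).trace =
      ((P k).submatrix f f * (Q k).submatrix g g).trace := by
    rw [trace_mul_lift, trace_mul_flip]
    simp [Matrix.trace, Matrix.mul_apply, Matrix.kroneckerMap_apply]
  rw [this]
  exact trace_mul_re_nonneg ((hP k).submatrix f) ((hQ k).submatrix g)

/-- The pair of extreme Werner states is discriminated perfectly by a global measurement and only
weakly by a separable one. -/
theorem exists_perfect_werner (hf : f.Injective) (hg : g.Injective) (hm : 2 ≤ Fintype.card m) :
    ∃ (ρ σ : Matrix (a × b) (a × b) ℂ) (p : ℝ), Perfect ρ σ p ∧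
      1 / 2 * (1 - 1 / (Fintype.card m : ℝ)) ≤ errorProb (SEP a b) ρ σ p := by
  set n : ℝ := (Fintype.card m : ℝ) with hn
  have hn2 : (2 : ℝ) ≤ n := by rw [hn]; exact_mod_cast hm
  have hn1 : 0 < n - 1 := by linarith
  set ρ := ((2 / (n * (n + 1)) : ℝ) : ℂ) • lift f g (symProj m) with hρ
  set σ := ((2 / (n * (n - 1)) : ℝ) : ℂ) • lift f g (asymProj m) with hσ
  -- The priors are proportional to the ranks n(n+1)/2 and n(n-1)/2, so both projections get weight
  -- 1/n² and their difference is the flip.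
  set p : ℝ := (n + 1) / (2 * n) with hp
  have hS := (posSemidef_of_projection (symProj_conjTranspose (m := m)) symProj_mul_self)
  have hA := (posSemidef_of_projection (asymProj_conjTranspose (m := m)) asymProj_mul_self)
  have hρs : IsState ρ := by
    refine ⟨(hS.mul_mul_conjTranspose_same _).smul ?_, ?_⟩
    · exact_mod_cast (by positivity : (0 : ℝ) ≤ 2 / (n * (n + 1)))
    · rw [hρ, Matrix.trace_smul, trace_lift hf hg, trace_symProj, smul_eq_mul,
        ← Complex.ofReal_mul, ← hn]
      norm_cast; field_simp
  have hσs : IsState σ := by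
    refine ⟨(hA.mul_mul_conjTranspose_same _).smul ?_, ?_⟩
    · exact_mod_cast (by positivity : (0 : ℝ) ≤ 2 / (n * (n - 1)))
    · rw [hσ, Matrix.trace_smul, trace_lift hf hg, trace_asymProj, smul_eq_mul,
        ← Complex.ofReal_mul, ← hn]
      norm_cast; field_simp
  have hp0 : 0 ≤ p := by positivity
  have hp1 : p ≤ 1 := by rw [hp, div_le_one (by linarith)]; linarith
  have hX : weighted ρ σ p = ((1 / n ^ 2 : ℝ) : ℂ) • lift f g (flip m) := by
    rw [weighted, hρ, hσ, smul_smul, smul_smul, ← Complex.ofReal_mul, ← Complex.ofReal_mul]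
    have e1 : p * (2 / (n * (n + 1))) = 1 / n ^ 2 := by rw [hp]; field_simp
    have e2 : (1 - p) * (2 / (n * (n - 1))) = 1 / n ^ 2 := by
      rw [hp]; field_simp; ring
    rw [e1, e2, ← smul_sub, ← lift_sub, symProj_sub_asymProj]
  have htr : ∀ E : Matrix (a × b) (a × b) ℂ, (E * weighted ρ σ p).trace.re =
      1 / n ^ 2 * (E * lift f g (flip m)).trace.re := fun E => by
    rw [hX, Matrix.mul_smul, Matrix.trace_smul, smul_eq_mul, Complex.re_ofReal_mul]
  have htF : (lift f g (flip m)).trace.re = n := by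
    rw [trace_lift hf hg, trace_flip, Complex.natCast_re]
  refine ⟨ρ, σ, p, ⟨hρs, hσs, hp0, hp1, le_antisymm ?_ ?_⟩, ?_⟩
  · have hPc : (lift f g (symProj m)).conjTranspose = lift f g (symProj m) := by
      rw [lift_conjTranspose, symProj_conjTranspose]
    have hPP : lift f g (symProj m) * lift f g (symProj m) = lift f g (symProj m) := by
      rw [lift_mul_lift hf hg, symProj_mul_self]
    have hE : ALL (a × b) Bool fun s => if s then lift f g (symProj m)
        else 1 - lift f g (symProj m) := by
      refine ⟨?_, by simp⟩
      rintro (_ | _)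
      · refine posSemidef_of_projection ?_ ?_
        · simp [hPc]
        · simp [mul_sub, sub_mul, hPP]
      · exact posSemidef_of_projection hPc hPP
    have := (le_abs_self _).trans
      (abs_trace_le_of_binary (fun _ _ _ h => h) hρs hσs hp0 hp1 hE)
    rw [htr] at this
    simp only [if_true, Bool.false_eq_true, if_false, Matrix.sub_mul, Matrix.one_mul,
      Matrix.trace_sub, Complex.sub_re, htF, lift_mul_lift hf hg, symProj_mul_flip] at this
    rw [trace_lift hf hg, trace_symProj, Complex.ofReal_re, ← hn] at this
    have e : 1 / n ^ 2 * (n * (n + 1) / 2 - (n - n * (n + 1) / 2)) = 1 := by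
      field_simp; ring
    linarith
  · exact errorProb_nonneg (fun _ _ _ h => h) hρs hσs hp0 hp1
  · refine le_errorProb ⟨Unit, inferInstance, fun _ => 1,
      ⟨fun _ => Matrix.PosSemidef.one, by simp⟩, fun _ => IsSeparable.one⟩ ?_
    intro I _ E q hE hq
    rw [error_eq hE.1.2 hρs hσs]
    have hsum : ∑ i, (E i * lift f g (flip m)).trace.re = n := by
      rw [← Complex.re_sum, ← Matrix.trace_sum, ← Finset.sum_mul, hE.1.2, one_mul, htF]
    -- All terms are nonnegative, so always answering `ρ` is optimal and the outcome carries no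
    -- information.
    have hle : ∑ i, (q i - 1 / 2) * (E i * weighted ρ σ p).trace.re ≤
        ∑ i, 1 / 2 * (1 / n ^ 2) * (E i * lift f g (flip m)).trace.re := by
      refine Finset.sum_le_sum fun i _ => ?_
      rw [htr, ← mul_assoc]
      refine mul_le_mul_of_nonneg_right (mul_le_mul_of_nonneg_right ?_ (by positivity))
        (hE.2 i).trace_mul_lift_flip_nonneg
      linarith [(hq i).2]
    rw [← Finset.mul_sum, hsum] at hle
    have e : 1 / 2 * (1 / n ^ 2) * n = 1 / 2 * (1 / n) := by field_simp
    linarith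

/-- A trivial example of perfect discrimination. -/
lemma exists_perfect {d : Type} [Fintype d] [DecidableEq d] [Nonempty d] :
    ∃ (ρ σ : Matrix d d ℂ) (p : ℝ), Perfect ρ σ p := by
  obtain ⟨i⟩ := ‹Nonempty d›
  have h : IsState (Matrix.single i i 1 : Matrix d d ℂ) := by
    refine ⟨?_, by simp⟩
    exact basisEffect_mem_ALL.1 i
  refine ⟨_, _, 1, h, h, zero_le_one, le_rfl, le_antisymm ?_ ?_⟩
  · have := errorProb_le (M := ALL d) (fun _ _ _ h => h) h h zero_le_one le_rfl (I := Unit)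
      (E := fun _ => 1) ⟨fun _ => Matrix.PosSemidef.one, by simp⟩ (q := fun _ => 1)
      (fun _ => ⟨zero_le_one, le_rfl⟩)
    simpa using this
  · exact errorProb_nonneg (fun _ _ _ h => h) h h zero_le_one le_rfl

theorem card_le_dhRatio_SEP (hf : f.Injective) (hg : g.Injective) [Nonempty m]
    (hlt : ∀ (ρ σ : Matrix (a × b) (a × b) ℂ) p, Perfect ρ σ p →
      errorProb (SEP a b) ρ σ p < 1 / 2) :
    (Fintype.card m : ℝ≥0∞) ≤ dhRatio (SEP a b) := by
  have h1 : (1 : ℝ) ≤ Fintype.card m := by exact_mod_cast Fintype.card_pos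
  rw [← ENNReal.ofReal_natCast]
  by_cases hm : 2 ≤ Fintype.card m
  · obtain ⟨ρ, σ, p, h, he⟩ := exists_perfect_werner hf hg hm
    exact h.le_dhRatio h1 he (hlt ρ σ p h)
  -- The antisymmetric subspace is zero here; as the bound on the error is 0, any perfect pair will
  -- do.
  · have hm1 : Fintype.card m = 1 := by have := Fintype.card_pos (α := m); omega
    obtain ⟨i⟩ := ‹Nonempty m›
    have : Nonempty (a × b) := ⟨(f i, g i)⟩
    obtain ⟨ρ, σ, p, h⟩ := exists_perfect (d := a × b)
    refine h.le_dhRatio h1 ?_ (hlt ρ σ p h)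
    rw [hm1]
    simpa using errorProb_nonneg SEP_le_ALL h.left h.right h.nonneg h.le_one

end

/-! Contractions as combinations of effects with coefficients in the unit disc -/

section

variable {m : Type} [Fintype m] [DecidableEq m]

/-- Operators `∑ c_k P_k` with `|c_k| ≤ 1` for a measurement `(P_k)`. -/
def IsDiscCombination (B : Matrix m m ℂ) : Prop :=
  ∃ (K : Type) (_ : Fintype K) (c : K → ℂ) (P : K → Matrix m m ℂ),
    (∀ k, ‖c k‖ ≤ 1) ∧ ALL m K P ∧ B = ∑ k, c k • P k

-- The spectral decomposition: the eigenvalues lie on the unit circle, and the spectral projections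
-- are the functional calculus of indicator functions, continuous on the finite spectrum.
open scoped Matrix.Norms.L2Operator in
lemma isDiscCombination_of_unitary {U : Matrix m m ℂ} (hU : U ∈ Matrix.unitaryGroup m ℂ) :
    IsDiscCombination U := by
  have hfin : (spectrum ℂ U).Finite := Matrix.finite_spectrum U
  have hN : IsStarNormal U := by
    refine ⟨?_⟩
    rw [Commute, SemiconjBy, (Matrix.mem_unitaryGroup_iff').mp hU, Matrix.mem_unitaryGroup_iff.mp hU]
  have hc : ∀ f : ℂ → ℂ, ContinuousOn f (spectrum ℂ U) := fun f => hfin.continuousOn f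
  let _ : Fintype (spectrum ℂ U) := hfin.fintype
  let χ : spectrum ℂ U → ℂ → ℂ := fun l z => if z = l then 1 else 0
  refine ⟨spectrum ℂ U, inferInstance, fun l => l, fun l => cfc (χ l) U, fun l => ?_,
    ⟨fun l => ?_, ?_⟩, ?_⟩
  · have := Unitary.spectrum_subset_circle ⟨U, hU⟩ l.2
    rw [mem_sphere_zero_iff_norm] at this
    exact this.le
  · refine posSemidef_of_projection ?_ ?_
    · rw [← Matrix.star_eq_conjTranspose, ← cfc_star]
      congr 1
      funext z
      by_cases h : z = l <;> simp [χ, h]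
    · rw [← cfc_mul _ _ _ (hc _) (hc _)]
      congr 1
      funext z
      by_cases h : z = l <;> simp [χ, h]
  · rw [← cfc_sum_univ _ _ fun _ => hc _, ← cfc_one ℂ U]
    refine cfc_congr fun z hz => ?_
    rw [Finset.sum_apply, Finset.sum_eq_single ⟨z, hz⟩]
    · simp [χ]
    · intro l _ hl
      simp only [χ]
      rw [if_neg]
      rintro rfl
      exact hl rfl
    · simp
  · have h1 : ∀ l : spectrum ℂ U, (l : ℂ) • cfc (χ l) U = cfc (fun z => l * χ l z) U :=
      fun l => (cfc_const_mul _ _ _ (hc _)).symm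
    simp only [h1]
    rw [← cfc_sum_univ _ _ fun _ => hc _]
    nth_rewrite 1 [← cfc_id ℂ U]
    refine cfc_congr fun z hz => ?_
    rw [Finset.sum_apply, Finset.sum_eq_single ⟨z, hz⟩]
    · simp [χ]
    · intro l _ hl
      simp only [χ]
      rw [if_neg, mul_zero]
      rintro rfl
      exact hl rfl
    · simp

lemma IsDiscCombination.average {B B' : Matrix m m ℂ} (h : IsDiscCombination B)
    (h' : IsDiscCombination B') : IsDiscCombination ((1 / 2 : ℂ) • (B + B')) := by
  obtain ⟨K, _, c, P, hc, hP, rfl⟩ := h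
  obtain ⟨K', _, c', P', hc', hP', rfl⟩ := h'
  refine ⟨K ⊕ K', inferInstance, Sum.elim c c',
    Sum.elim (fun k => (1 / 2 : ℂ) • P k) (fun k => (1 / 2 : ℂ) • P' k), ?_, ⟨?_, ?_⟩, ?_⟩
  · rintro (k | k)
    · exact hc k
    · exact hc' k
  · have h2 : (0 : ℂ) ≤ 1 / 2 := by positivity
    rintro (k | k)
    · exact (hP.1 k).smul h2
    · exact (hP'.1 k).smul h2
  · simp only [Fintype.sum_sum_type, Sum.elim_inl, Sum.elim_inr, ← Finset.smul_sum, hP.2, hP'.2]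
    rw [← add_smul]; norm_num
  · simp only [Fintype.sum_sum_type, Sum.elim_inl, Sum.elim_inr, smul_add, Finset.smul_sum]
    congr 1 <;> exact Finset.sum_congr rfl fun k _ => smul_comm _ _ _

/-! The polar decomposition -/

lemma isCompact_unitaryGroup :
    IsCompact {U : Matrix m m ℂ | U ∈ Matrix.unitaryGroup m ℂ} := by
  have hK : IsCompact (Set.pi Set.univ fun _ : m => Set.pi Set.univ fun _ : m =>
      Metric.closedBall (0 : ℂ) 1) :=
    isCompact_univ_pi fun _ => isCompact_univ_pi fun _ => isCompact_closedBall _ _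
  refine IsCompact.of_isClosed_subset (X := Matrix m m ℂ) hK ?_ ?_
  · simp only [Matrix.mem_unitaryGroup_iff]
    exact isClosed_eq (by fun_prop) continuous_const
  · intro U hU i _ j _
    rw [mem_closedBall_zero_iff]
    exact entry_norm_bound_of_unitary hU i j

/-- The unitary that multiplies `v` by the phase `z`. -/
lemma one_add_smul_vecMulVec_mem_unitaryGroup (v : m → ℂ) {z : ℂ} (hz : ‖z‖ = 1)
    (hv : star v ⬝ᵥ v = 1) :
    1 + (z - 1) • Matrix.vecMulVec v (star v) ∈ Matrix.unitaryGroup m ℂ := by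
  rw [Matrix.mem_unitaryGroup_iff, Matrix.star_eq_conjTranspose, Matrix.conjTranspose_add,
    Matrix.conjTranspose_one, Matrix.conjTranspose_smul, Matrix.conjTranspose_vecMulVec, star_star]
  have h1 : Matrix.vecMulVec v (star v) * Matrix.vecMulVec v (star v) =
      Matrix.vecMulVec v (star v) := by
    rw [Matrix.vecMulVec_mul_vecMulVec, hv, one_smul]
  have h2 : z * star z = 1 := by
    rw [Complex.star_def, Complex.mul_conj, Complex.normSq_eq_norm_sq, hz]; norm_num
  simp only [mul_add, add_mul, one_mul, mul_one, Matrix.smul_mul, Matrix.mul_smul, h1, smul_smul]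
  rw [add_assoc, ← add_smul, ← add_smul, star_sub, star_one]
  have : z - 1 + (star z - 1 + (star z - 1) * (z - 1)) = 0 := by linear_combination h2
  rw [this, zero_smul, add_zero]

lemma nonneg_of_re_mul_le {w : ℂ} (h : ∀ z : ℂ, ‖z‖ = 1 → (z * w).re ≤ w.re) : 0 ≤ w := by
  by_cases hw : w = 0
  · rw [hw]
  have hn : (‖w‖ : ℂ) ≠ 0 := by simpa using hw
  have h1 := h (star w / ‖w‖) (by simp [hw])
  have h2 : star w / ‖w‖ * w = ‖w‖ := by
    rw [div_mul_eq_mul_div, Complex.star_def, ← Complex.normSq_eq_conj_mul_self,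
      Complex.normSq_eq_norm_sq]
    field_simp
    push_cast
    ring
  rw [h2, Complex.ofReal_re] at h1
  have h3 : ‖w‖ = w.re := le_antisymm h1 (Complex.re_le_norm w)
  have h4 : 0 ≤ w.re := h3 ▸ norm_nonneg w
  exact Complex.nonneg_iff.mpr ⟨h4, (Complex.abs_re_eq_norm.mp (by rw [abs_of_nonneg h4, h3])).symm⟩

/-- The polar decomposition: `B = U M` with `M` positive semidefinite. -/
lemma exists_unitary_posSemidef (B : Matrix m m ℂ) :
    ∃ U ∈ Matrix.unitaryGroup m ℂ, (U.conjTranspose * B).PosSemidef := by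
  -- The polar factor is a maximiser of `Re Tr Uᴴ B`. Multiplying it by a unitary that rotates only
  -- a unit vector `v` shows that no phase increases the real part of `⟨v, M v⟩`, which is therefore
  -- nonnegative.
  obtain ⟨U, hU, hmax⟩ := isCompact_unitaryGroup (m := m) |>.exists_isMaxOn
    ⟨1, one_mem (Matrix.unitaryGroup m ℂ)⟩
    (f := fun U : Matrix m m ℂ => (U.conjTranspose * B).trace.re)
    (Complex.continuous_re.comp (by fun_prop)).continuousOn
  refine ⟨U, hU, posSemidef_of_forall_nonneg fun v => ?_⟩
  set M := U.conjTranspose * B with hM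
  have key : ∀ v : m → ℂ, star v ⬝ᵥ v = 1 → 0 ≤ star v ⬝ᵥ M.mulVec v := by
    intro v hv
    refine nonneg_of_re_mul_le fun z hz => ?_
    have hV := one_add_smul_vecMulVec_mem_unitaryGroup v (z := star z) (by simpa using hz) hv
    have := hmax (mul_mem hU hV)
    simp only [Set.mem_ofPred_eq, Matrix.conjTranspose_mul, Matrix.conjTranspose_add,
      Matrix.conjTranspose_one, Matrix.conjTranspose_smul, Matrix.conjTranspose_vecMulVec,
      star_star, Matrix.mul_assoc, ← hM, add_mul, one_mul, Matrix.smul_mul, Matrix.trace_add,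
      Matrix.trace_smul, star_sub, star_one] at this
    have e : (Matrix.vecMulVec v (star v) * M).trace = star v ⬝ᵥ M.mulVec v := by
      rw [Matrix.trace_mul_comm, Matrix.mul_vecMulVec, Matrix.trace_vecMulVec, dotProduct_comm]
    rw [e, smul_eq_mul, sub_mul, one_mul, Complex.add_re, Complex.sub_re] at this
    linarith
  by_cases hv : v = 0
  · simp [hv]
  set r : ℝ := Real.sqrt (∑ i, ‖v i‖ ^ 2) with hr
  have hvv : star v ⬝ᵥ v = ((∑ i, ‖v i‖ ^ 2 : ℝ) : ℂ) := by
    rw [dotProduct]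
    push_cast
    refine Finset.sum_congr rfl fun i _ => ?_
    rw [Pi.star_apply, Complex.star_def, ← Complex.normSq_eq_conj_mul_self,
      Complex.normSq_eq_norm_sq, Complex.ofReal_pow]
  have hpos : 0 < ∑ i, ‖v i‖ ^ 2 := by
    obtain ⟨i, hi⟩ := Function.ne_iff.mp hv
    exact Finset.sum_pos' (fun _ _ => by positivity) ⟨i, Finset.mem_univ i, by
      have : 0 < ‖v i‖ := norm_pos_iff.mpr hi
      positivity⟩
  have hr0 : 0 < r := Real.sqrt_pos.mpr hpos
  have hrr : r * r = ∑ i, ‖v i‖ ^ 2 := Real.mul_self_sqrt hpos.le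
  have hrc : (r : ℂ) ≠ 0 := by exact_mod_cast hr0.ne'
  have hvw : v = (r : ℂ) • ((r : ℂ)⁻¹ • v) := by rw [smul_smul, mul_inv_cancel₀ hrc, one_smul]
  have hw := key ((r : ℂ)⁻¹ • v) (by
    rw [star_smul, smul_dotProduct, dotProduct_smul, hvv, ← hrr]
    simp only [smul_eq_mul, star_inv₀, Complex.star_def, Complex.conj_ofReal]
    push_cast
    field_simp)
  rw [hvw, star_smul, Matrix.mulVec_smul, smul_dotProduct, dotProduct_smul]
  refine mul_nonneg ?_ (mul_nonneg ?_ hw)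
  · rw [Complex.star_def, Complex.conj_ofReal]; exact_mod_cast hr0.le
  · exact_mod_cast hr0.le

lemma sum_sq_norm_eq_trace {m' : Type} [Fintype m'] (B : Matrix m' m' ℂ) :
    ((∑ i, ∑ j, ‖B i j‖ ^ 2 : ℝ) : ℂ) = (B.conjTranspose * B).trace := by
  simp only [Matrix.trace, Matrix.diag_apply, Matrix.mul_apply, Matrix.conjTranspose_apply]
  rw [Finset.sum_comm]
  push_cast
  refine Finset.sum_congr rfl fun i _ => Finset.sum_congr rfl fun j _ => ?_
  rw [Complex.star_def, ← Complex.normSq_eq_conj_mul_self, Complex.normSq_eq_norm_sq,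
    Complex.ofReal_pow]

/-- Matrices in the unit ball of the Hilbert–Schmidt norm are averages of two unitaries. -/
lemma isDiscCombination_of_sum_sq_le {B : Matrix m m ℂ} (hB : ∑ i, ∑ j, ‖B i j‖ ^ 2 ≤ 1) :
    IsDiscCombination B := by
  obtain ⟨U, hU, hM⟩ := exists_unitary_posSemidef B
  set M := U.conjTranspose * B with hMdef
  have hUU : U * U.conjTranspose = 1 := Matrix.mem_unitaryGroup_iff.mp hU
  have hBM : B = U * M := by rw [hMdef, ← Matrix.mul_assoc, hUU, Matrix.one_mul]
  set Q : Matrix m m ℂ := (hM.1.eigenvectorUnitary : Matrix m m ℂ) with hQ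
  have hQm : Q ∈ Matrix.unitaryGroup m ℂ := (hM.1.eigenvectorUnitary).2
  have hQQ : Q.conjTranspose * Q = 1 := Matrix.mem_unitaryGroup_iff'.mp hQm
  have hQQ' : Q * Q.conjTranspose = 1 := Matrix.mem_unitaryGroup_iff.mp hQm
  set l : m → ℝ := hM.1.eigenvalues with hl
  have hspec : M = Q * Matrix.diagonal (fun i => (l i : ℂ)) * Q.conjTranspose := by
    have := hM.1.spectral_theorem
    rw [Unitary.conjStarAlgAut_apply] at this
    exact this
  have hl0 : ∀ i, 0 ≤ l i := hM.eigenvalues_nonneg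
  have hsum : ∑ i, l i ^ 2 ≤ 1 := by
    have h1 : ((∑ i, l i ^ 2 : ℝ) : ℂ) = (M.conjTranspose * M).trace := by
      rw [hM.1.eq, hspec]
      have : Q * Matrix.diagonal (fun i => (l i : ℂ)) * Q.conjTranspose *
          (Q * Matrix.diagonal (fun i => (l i : ℂ)) * Q.conjTranspose) =
          Q * (Matrix.diagonal (fun i => (l i : ℂ)) * (Q.conjTranspose * Q) *
            Matrix.diagonal (fun i => (l i : ℂ)) * Q.conjTranspose) := by
        simp only [Matrix.mul_assoc]
      rw [this, hQQ, Matrix.trace_mul_comm, Matrix.mul_one, Matrix.mul_assoc, Matrix.mul_assoc,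
        hQQ, Matrix.mul_one, Matrix.diagonal_mul_diagonal, Matrix.trace_diagonal]
      push_cast
      exact Finset.sum_congr rfl fun i _ => sq _
    have h2 : M.conjTranspose * M = B.conjTranspose * B := by
      rw [hMdef, Matrix.conjTranspose_mul, Matrix.conjTranspose_conjTranspose, Matrix.mul_assoc,
        ← Matrix.mul_assoc U, hUU, Matrix.one_mul]
    rw [h2, ← sum_sq_norm_eq_trace] at h1
    rw [Complex.ofReal_injective h1]
    exact hB
  have hl1 : ∀ i, l i ^ 2 ≤ 1 := fun i =>
    (Finset.single_le_sum (f := fun i => l i ^ 2) (fun j _ => sq_nonneg (l j))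
      (Finset.mem_univ i)).trans hsum
  -- A singular value `l ≤ 1` is the mean of the unimodular numbers `l ± i√(1 - l²)`; the signs `s =
  -- ±1` give the two unitaries.
  have hW : ∀ s : ℝ, s ^ 2 = 1 →
      U * (Q * Matrix.diagonal (fun i => (l i : ℂ) + (s * Real.sqrt (1 - l i ^ 2) : ℝ) * Complex.I) *
        Q.conjTranspose) ∈ Matrix.unitaryGroup m ℂ := by
    intro s hs
    refine mul_mem hU (mul_mem (mul_mem hQm ?_) (Unitary.star_mem hQm))
    rw [Matrix.mem_unitaryGroup_iff, Matrix.star_eq_conjTranspose, Matrix.diagonal_conjTranspose,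
      Matrix.diagonal_mul_diagonal, ← Matrix.diagonal_one]
    congr 1
    funext i
    rw [Pi.star_apply, Complex.star_def, Complex.mul_conj, Complex.normSq_add_mul_I, mul_pow, hs,
      Real.sq_sqrt (by linarith [hl1 i])]
    norm_num
  have := (isDiscCombination_of_unitary (hW 1 (by norm_num))).average
    (isDiscCombination_of_unitary (hW (-1) (by norm_num)))
  convert this using 1
  rw [hBM, hspec, ← Matrix.mul_add, ← Matrix.add_mul, ← Matrix.mul_add, Matrix.diagonal_add,
    ← Matrix.mul_smul, ← Matrix.smul_mul, ← Matrix.mul_smul]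
  congr 3
  ext i j
  by_cases h : i = j
  · subst h
    simp
    ring
  · simp [h]

end

/-! The separable ball around the identity -/

section

variable {a b : Type} [Fintype a] [Fintype b] [DecidableEq a] [DecidableEq b]

/-- For `i ≠ j` this is the block with rows `(s, c)`, `(c̄, 1/s)` of determinant `1 - |c|² ≥ 0`.
Completing the square into two rank-one terms also covers `i = j`. -/
lemma posSemidef_pair (i j : a) {s : ℝ} (hs : 0 < s) {c : ℂ} (hc : ‖c‖ ≤ 1) :
    ((s : ℂ) • Matrix.single i i (1 : ℂ) + ((s⁻¹ : ℝ) : ℂ) • Matrix.single j j (1 : ℂ) +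
      c • Matrix.single i j (1 : ℂ) + star c • Matrix.single j i (1 : ℂ)).PosSemidef := by
  set v : a → ℂ := Pi.single i 1 with hv
  set w : a → ℂ := Pi.single j 1 with hw
  have e : ∀ k l : a, Matrix.single k l (1 : ℂ) =
      Matrix.vecMulVec (Pi.single k 1) (star (Pi.single l 1)) := fun k l => by
    rw [← Pi.single_star, star_one, ← Matrix.single_eq_single_vecMulVec_single]
  have hsc : (s : ℂ) ≠ 0 := by exact_mod_cast hs.ne'
  have hcc : star c * c = ((‖c‖ ^ 2 : ℝ) : ℂ) := by
    rw [Complex.star_def, ← Complex.normSq_eq_conj_mul_self, Complex.normSq_eq_norm_sq]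
  have key : (s : ℂ) • Matrix.single i i (1 : ℂ) + ((s⁻¹ : ℝ) : ℂ) • Matrix.single j j (1 : ℂ) +
      c • Matrix.single i j (1 : ℂ) + star c • Matrix.single j i (1 : ℂ) =
      (s : ℂ) • Matrix.vecMulVec (v + ((s : ℂ)⁻¹ * star c) • w) (star (v + ((s : ℂ)⁻¹ * star c) • w))
      + ((s⁻¹ * (1 - ‖c‖ ^ 2) : ℝ) : ℂ) • Matrix.vecMulVec w (star w) := by
    simp only [e, ← hv, ← hw, star_add, star_smul, star_mul', star_star, star_inv₀,
      Matrix.add_vecMulVec, Matrix.vecMulVec_add, Matrix.smul_vecMulVec, Matrix.vecMulVec_smul,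
      Complex.ofReal_mul, Complex.ofReal_sub, ← hcc, Complex.ofReal_one, Complex.ofReal_inv]
    have hss : star (s : ℂ) = s := by rw [Complex.star_def, Complex.conj_ofReal]
    simp only [hss, smul_add, smul_smul]
    have e1 : (s : ℂ) * ((s : ℂ)⁻¹ * c) = c := by field_simp
    have e2 : (s : ℂ) * ((s : ℂ)⁻¹ * star c) = star c := by field_simp
    have e3 : (s : ℂ) * ((s : ℂ)⁻¹ * c * ((s : ℂ)⁻¹ * star c)) = (s : ℂ)⁻¹ * (star c * c) := by
      field_simp
    simp only [e1, e2, e3]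
    module
  rw [key]
  refine ((Matrix.posSemidef_vecMulVec_self_star _).smul ?_).add
    ((Matrix.posSemidef_vecMulVec_self_star _).smul ?_)
  · exact_mod_cast hs.le
  · have : 0 ≤ s⁻¹ * (1 - ‖c‖ ^ 2) :=
      mul_nonneg (inv_nonneg.mpr hs.le) (by nlinarith [norm_nonneg c])
    exact_mod_cast this

/-- The off-diagonal blocks `B`, `Bᴴ` become separable on adding multiples of the identity with the
weight of `B` to the diagonal blocks. -/
lemma isSeparable_pair (i j : a) {s N : ℝ} (hs : 0 < s) (hN : 0 < N) {B : Matrix b b ℂ}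
    (hB : ∑ y, ∑ y', ‖B y y'‖ ^ 2 ≤ N ^ 2) :
    IsSeparable (((N * s : ℝ) : ℂ) • (Matrix.single i i (1 : ℂ) ⊗ₖ (1 : Matrix b b ℂ)) +
      ((N * s⁻¹ : ℝ) : ℂ) • (Matrix.single j j (1 : ℂ) ⊗ₖ (1 : Matrix b b ℂ)) +
      Matrix.single i j (1 : ℂ) ⊗ₖ B + Matrix.single j i (1 : ℂ) ⊗ₖ B.conjTranspose) := by
  have hNc : (N : ℂ) ≠ 0 := by exact_mod_cast hN.ne'
  obtain ⟨K, _, c, P, hc, hP, hBP⟩ : IsDiscCombination ((N : ℂ)⁻¹ • B) := by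
    refine isDiscCombination_of_sum_sq_le ?_
    have : ∀ y y', ‖((N : ℂ)⁻¹ • B) y y'‖ ^ 2 = (N ^ 2)⁻¹ * ‖B y y'‖ ^ 2 := fun y y' => by
      rw [Matrix.smul_apply, norm_smul, norm_inv, Complex.norm_real, Real.norm_eq_abs,
        abs_of_pos hN, mul_pow, inv_pow]
    simp only [this, ← Finset.mul_sum]
    rw [inv_mul_le_iff₀ (by positivity), mul_one]
    exact hB
  have hB' : B = (N : ℂ) • ∑ k, c k • P k := by
    rw [← hBP, smul_smul, mul_inv_cancel₀ hNc, one_smul]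
  have hB'' : B.conjTranspose = (N : ℂ) • ∑ k, star (c k) • P k := by
    have hNs : star (N : ℂ) = N := by rw [Complex.star_def, Complex.conj_ofReal]
    rw [hB', Matrix.conjTranspose_smul, Matrix.conjTranspose_sum, hNs]
    congr 1
    refine Finset.sum_congr rfl fun k _ => ?_
    rw [Matrix.conjTranspose_smul, (hP.1 k).1.eq]
  -- As `∑ P k = 1`, the diagonal terms split along the same effects as `B`, leaving products of a
  -- positive two-level block with `P k`.
  have key : ((N * s : ℝ) : ℂ) • (Matrix.single i i (1 : ℂ) ⊗ₖ (1 : Matrix b b ℂ)) +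
      ((N * s⁻¹ : ℝ) : ℂ) • (Matrix.single j j (1 : ℂ) ⊗ₖ (1 : Matrix b b ℂ)) +
      Matrix.single i j (1 : ℂ) ⊗ₖ B + Matrix.single j i (1 : ℂ) ⊗ₖ B.conjTranspose =
      (N : ℂ) • ∑ k, ((s : ℂ) • Matrix.single i i (1 : ℂ) +
        ((s⁻¹ : ℝ) : ℂ) • Matrix.single j j (1 : ℂ) +
        c k • Matrix.single i j (1 : ℂ) + star (c k) • Matrix.single j i (1 : ℂ)) ⊗ₖ P k := by
    rw [hB'', ← hP.2]
    nth_rewrite 1 [hB']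
    simp only [Matrix.add_kronecker, Finset.sum_add_distrib, Matrix.smul_kronecker,
      ← Finset.smul_sum, kronecker_sum, Matrix.kronecker_smul, smul_add, smul_smul,
      Complex.ofReal_mul]
    simp only [← Matrix.kronecker_smul, kronecker_sum]
  rw [key]
  exact IsSeparable.smul (IsSeparable.sum _ fun k _ =>
    IsSeparable.kronecker (posSemidef_pair i j hs (hc k)) (hP.1 k)) (by exact_mod_cast hN.le)

/-- The Gurvits–Barnum theorem: the ball of radius one around the identity in the Hilbert–Schmidt
norm consists of separable operators. -/
theorem isSeparable_one_add {D : Matrix (a × b) (a × b) ℂ} (hD : D.IsHermitian)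
    (hD1 : ∑ x, ∑ y, ‖D x y‖ ^ 2 ≤ 1) : IsSeparable (1 + D) := by
  let B : a → a → Matrix b b ℂ := fun i j => Matrix.of fun y y' => D (i, y) (j, y')
  have hBc : ∀ i j, (B i j).conjTranspose = B j i := fun i j => by
    ext y y'
    exact hD.apply _ _
  let S : a → a → ℝ := fun i j => ∑ y, ∑ y', ‖B i j y y'‖ ^ 2
  have hS0 : ∀ i j, 0 ≤ S i j := fun i j => by positivity
  have hSs : ∀ i j, S i j = S j i := fun i j => by
    simp only [S]
    rw [Finset.sum_comm, ← hBc j i]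
    simp [Matrix.conjTranspose_apply]
  -- `N i j` is the norm of a block and `r i` that of a row of blocks; `r` plays the role of a
  -- Perron vector in the weights `r j / r i` below.
  let N : a → a → ℝ := fun i j => Real.sqrt (S i j)
  let r : a → ℝ := fun i => Real.sqrt (∑ j, S i j)
  have hNs : ∀ i j, N i j = N j i := fun i j => congrArg Real.sqrt (hSs i j)
  have hN0 : ∀ i j, 0 ≤ N i j := fun i j => Real.sqrt_nonneg _
  have hNr : ∀ i j, 0 < N i j → 0 < r i := fun i j h =>
    Real.sqrt_pos.mpr ((Real.sqrt_pos.mp h).trans_le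
      (Finset.single_le_sum (f := fun j => S i j) (fun j _ => hS0 i j) (Finset.mem_univ j)))
  have hr1 : ∑ i, r i ^ 2 ≤ 1 := by
    have : ∀ i, r i ^ 2 = ∑ j, S i j := fun i =>
      Real.sq_sqrt (Finset.sum_nonneg fun j _ => hS0 i j)
    simp only [this]
    refine le_trans (le_of_eq ?_) hD1
    simp only [S, B, Matrix.of_apply, Fintype.sum_prod_type]
    exact Finset.sum_congr rfl fun i _ => Finset.sum_comm
  -- Cauchy–Schwarz gives `∑ j, N i j * r j ≤ r i * ‖r‖ ≤ r i`. If `r i = 0`, the quotients are 0 by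
  -- convention.
  have hrow : ∀ i, ∑ j, N i j * (r j / r i) ≤ 1 := fun i => by
    by_cases hi : r i = 0
    · simp [hi]
    have hi' : 0 < r i := lt_of_le_of_ne (Real.sqrt_nonneg _) (Ne.symm hi)
    have h1 : ∑ j, N i j * (r j / r i) = (∑ j, N i j * r j) / r i := by
      rw [Finset.sum_div]; exact Finset.sum_congr rfl fun j _ => by ring
    rw [h1, div_le_one hi']
    have h2 := Real.sum_mul_le_sqrt_mul_sqrt Finset.univ (N i) r
    have h3 : ∑ j, N i j ^ 2 = ∑ j, S i j :=
      Finset.sum_congr rfl fun j _ => Real.sq_sqrt (hS0 i j)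
    rw [h3] at h2
    refine h2.trans (mul_le_of_le_one_right (Real.sqrt_nonneg _) ?_)
    rwa [Real.sqrt_le_left zero_le_one, one_pow]
  let e : a → a → Matrix a a ℂ := fun i j => Matrix.single i j 1
  let T : a → a → Matrix (a × b) (a × b) ℂ := fun i j =>
    ((N i j * (r j / r i) : ℝ) : ℂ) • (e i i ⊗ₖ (1 : Matrix b b ℂ)) +
      ((N i j * (r j / r i)⁻¹ : ℝ) : ℂ) • (e j j ⊗ₖ (1 : Matrix b b ℂ)) +
      e i j ⊗ₖ B i j + e j i ⊗ₖ (B i j).conjTranspose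
  have hT : ∀ i j, IsSeparable (T i j) := fun i j => by
    -- The weight `r j / r i` need not be positive when the block vanishes, but then `T i j = 0`.
    rcases (hN0 i j).eq_or_lt with h | h
    · have hB0 : B i j = 0 := by
        have hS : S i j = 0 := (Real.sqrt_eq_zero (hS0 i j)).mp h.symm
        ext y y'
        have h1 := (Finset.sum_eq_zero_iff_of_nonneg (fun y _ => by positivity)).mp hS y
          (Finset.mem_univ y)
        have h2 := (Finset.sum_eq_zero_iff_of_nonneg (fun y _ => by positivity)).mp h1 y'
          (Finset.mem_univ y')
        simpa using h2
      have : T i j = 0 := by simp [T, ← h, hB0]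
      rw [this]
      exact ⟨Empty, inferInstance, Empty.elim, Empty.elim, fun k => k.elim, fun k => k.elim, by simp⟩
    · refine isSeparable_pair i j (div_pos (hNr j i (hNs i j ▸ h)) (hNr i j h)) h ?_
      exact (Real.sq_sqrt (hS0 i j)).ge
  have hDsum : ∑ i, ∑ j, e i j ⊗ₖ B i j = D := by
    ext x y
    simp only [Matrix.sum_apply, Matrix.kroneckerMap_apply, e, Matrix.single_apply, B,
      Matrix.of_apply, ite_mul, one_mul, zero_mul, ite_and]
    simp
  have hDsum' : ∑ i, ∑ j, e j i ⊗ₖ (B i j).conjTranspose = D := by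
    simp only [hBc]
    rw [Finset.sum_comm]
    exact hDsum
  have h1 : ∑ i, e i i ⊗ₖ (1 : Matrix b b ℂ) = 1 := by
    rw [sum_kronecker]
    have : ∑ i, e i i = 1 := basisEffect_mem_ALL.2
    rw [this, Matrix.one_kronecker_one]
  have hdiag : ∑ i, ∑ j, ((N i j * (r j / r i)⁻¹ : ℝ) : ℂ) • (e j j ⊗ₖ (1 : Matrix b b ℂ)) =
      ∑ i, ∑ j, ((N i j * (r j / r i) : ℝ) : ℂ) • (e i i ⊗ₖ (1 : Matrix b b ℂ)) := by
    rw [Finset.sum_comm]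
    refine Finset.sum_congr rfl fun i _ => Finset.sum_congr rfl fun j _ => ?_
    rw [hNs j i, inv_div]
  -- Summing `T` over ordered pairs counts every block of `D` twice, hence the half; the identity
  -- left over in row `i` is nonnegative by `hrow`.
  have key : 1 + D = (1 / 2 : ℂ) • ∑ i, ∑ j, T i j +
      ∑ i, ((1 - ∑ j, N i j * (r j / r i) : ℝ) : ℂ) • (e i i ⊗ₖ (1 : Matrix b b ℂ)) := by
    simp only [T, Finset.sum_add_distrib, hDsum, hDsum', hdiag, Complex.ofReal_sub,
      Complex.ofReal_one, Complex.ofReal_sum, sub_smul, one_smul, Finset.sum_sub_distrib, h1,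
      Finset.sum_smul]
    module
  rw [key]
  refine IsSeparable.add (IsSeparable.smul (IsSeparable.sum _ fun i _ =>
    IsSeparable.sum _ fun j _ => hT i j) (by positivity)) (IsSeparable.sum _ fun i _ => ?_)
  refine IsSeparable.smul (IsSeparable.kronecker (basisEffect_mem_ALL.1 i) Matrix.PosSemidef.one) ?_
  exact_mod_cast sub_nonneg.mpr (hrow i)

/-! ### Separable discrimination for equal dimensions -/

lemma sum_sq_norm_le_of_test {d : Type} [Fintype d] [DecidableEq d] {P : Matrix d d ℂ}
    (hP : P.PosSemidef) (hP' : (1 - P).PosSemidef) :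
    ∑ x, ∑ y, ‖((2 : ℂ) • P - 1) x y‖ ^ 2 ≤ Fintype.card d := by
  have h1 := congrArg Complex.re (sum_sq_norm_eq_trace ((2 : ℂ) • P - 1))
  rw [Complex.ofReal_re] at h1
  -- `(2P - 1)² = 1 - 4P(1 - P)`, and the trace of `P(1 - P)` is nonnegative.
  have h2 : ((2 : ℂ) • P - 1).conjTranspose * ((2 : ℂ) • P - 1) = 1 - (4 : ℂ) • (P * (1 - P)) := by
    have : ((2 : ℂ) • P - 1).conjTranspose = (2 : ℂ) • P - 1 := by
      rw [Matrix.conjTranspose_sub, Matrix.conjTranspose_smul, hP.1.eq, Matrix.conjTranspose_one,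
        star_ofNat]
    rw [this]
    simp only [mul_sub, sub_mul, one_mul, mul_one, Matrix.smul_mul, Matrix.mul_smul]
    module
  rw [h2, Matrix.trace_sub, Matrix.trace_one, Matrix.trace_smul, Complex.sub_re,
    Complex.natCast_re, smul_eq_mul] at h1
  have h3 := trace_mul_re_nonneg hP hP'
  have h4 : ((4 : ℂ) * (P * (1 - P)).trace).re = 4 * (P * (1 - P)).trace.re := by
    rw [Complex.mul_re]; simp
  rw [h1, h4]
  linarith

/-- The squared norm of `D` is at most the total dimension, which is n² for equal dimensions; so
`D/n` is in the unit ball and `(1 ± D/n)/2` is a separable measurement. -/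
theorem Perfect.errorProb_SEP_le [Nonempty a] (hab : Fintype.card a = Fintype.card b)
    {ρ σ : Matrix (a × b) (a × b) ℂ} {p : ℝ} (h : Perfect ρ σ p) :
    errorProb (SEP a b) ρ σ p ≤ 1 / 2 * (1 - 1 / (Fintype.card a : ℝ)) := by
  have hn : (0 : ℝ) < Fintype.card a := by exact_mod_cast Fintype.card_pos
  refine h.errorProb_le_of_forall hn fun P hP hP' => ?_
  set n : ℝ := (Fintype.card a : ℝ) with hnd
  set D := (2 : ℂ) • P - 1 with hD
  have hDh : D.IsHermitian := by
    rw [hD, Matrix.IsHermitian, Matrix.conjTranspose_sub, Matrix.conjTranspose_smul, hP.1.eq,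
      Matrix.conjTranspose_one, star_ofNat]
  have hsep : ∀ s : ℝ, s ^ 2 = 1 → IsSeparable (1 + ((s / n : ℝ) : ℂ) • D) := fun s hs => by
    refine isSeparable_one_add ?_ ?_
    · rw [Matrix.IsHermitian, Matrix.conjTranspose_smul, hDh.eq, Complex.star_def,
        Complex.conj_ofReal]
    · have h1 := sum_sq_norm_le_of_test hP hP'
      have h2 : ∀ x y, ‖(((s / n : ℝ) : ℂ) • D) x y‖ ^ 2 = (n ^ 2)⁻¹ * ‖D x y‖ ^ 2 := fun x y => by
        rw [Matrix.smul_apply, norm_smul, Complex.norm_real, mul_pow, Real.norm_eq_abs, sq_abs,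
          div_pow, hs, one_div]
      simp only [h2, ← Finset.mul_sum]
      rw [inv_mul_le_iff₀ (by positivity), mul_one]
      refine h1.trans (le_of_eq ?_)
      rw [Fintype.card_prod, ← hab, sq, Nat.cast_mul]
  have hE : SEP a b Bool fun t => (1 / 2 : ℂ) • (1 + (((if t then 1 else -1) / n : ℝ) : ℂ) • D) := by
    have hs : ∀ t : Bool, IsSeparable
        ((1 / 2 : ℂ) • (1 + (((if t then 1 else -1) / n : ℝ) : ℂ) • D)) := fun t =>
      IsSeparable.smul (hsep _ (by cases t <;> norm_num)) (by positivity)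
    refine ⟨⟨fun t => (hs t).posSemidef, ?_⟩, hs⟩
    simp only [Fintype.sum_bool, if_true, Bool.false_eq_true, if_false, neg_div,
      Complex.ofReal_neg, neg_smul]
    module
  have := (le_abs_self _).trans
    (abs_trace_le_of_binary SEP_le_ALL h.left h.right h.nonneg h.le_one hE)
  beta_reduce at this
  have e : (1 / 2 : ℂ) • (1 + (((if (true : Bool) then 1 else -1) / n : ℝ) : ℂ) • D) -
      (1 / 2 : ℂ) • (1 + (((if (false : Bool) then 1 else -1) / n : ℝ) : ℂ) • D) =
      ((1 / n : ℝ) : ℂ) • D := by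
    simp only [if_true, Bool.false_eq_true, if_false, neg_div, Complex.ofReal_neg, neg_smul]
    module
  rw [e, Matrix.smul_mul, Matrix.trace_smul, smul_eq_mul, Complex.re_ofReal_mul] at this
  rwa [one_div, inv_mul_le_iff₀ hn] at this

/-! ### The chain of inequalities -/

theorem dhRatio_chain {m : Type} [Fintype m] [DecidableEq m] [Nonempty m] {f : m → a} {g : m → b}
    (hf : f.Injective) (hg : g.Injective) {M : MeasurementClass (a × b)} {c : ℝ} (hc : 0 < c)
    (hM : ∀ ρ σ p, Perfect ρ σ p → errorProb (LOCC a b) ρ σ p ≤ errorProb M ρ σ p)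
    (hMc : ∀ ρ σ p, Perfect ρ σ p → errorProb M ρ σ p ≤ 1 / 2 * (1 - 1 / c)) :
    (Fintype.card m : ℝ≥0∞) ≤ dhRatio (SEP a b) ∧ dhRatio (SEP a b) ≤ dhRatio (LOCC a b) ∧
      dhRatio (LOCC a b) ≤ dhRatio M ∧ dhRatio M ≤ ENNReal.ofReal c := by
  -- The bound for `M` does double duty: it also keeps every error probability in the chain below
  -- 1/2, as monotonicity of the ratios requires.
  have h1 : ∀ ρ σ p, Perfect ρ σ p → errorProb M ρ σ p < 1 / 2 := fun ρ σ p h => by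
    have : 0 < 1 / c := by positivity
    linarith [hMc ρ σ p h]
  have h2 : ∀ ρ σ p, Perfect ρ σ p → errorProb (LOCC a b) ρ σ p < 1 / 2 := fun ρ σ p h =>
    (hM ρ σ p h).trans_lt (h1 ρ σ p h)
  have h3 : ∀ ρ σ p, Perfect ρ σ p → errorProb (SEP a b) ρ σ p ≤ errorProb (LOCC a b) ρ σ p :=
    fun ρ σ p h => h.errorProb_SEP_le_LOCC
  exact ⟨card_le_dhRatio_SEP hf hg fun ρ σ p h => (h3 ρ σ p h).trans_lt (h2 ρ σ p h),
    dhRatio_mono h3 h2, dhRatio_mono hM h1, dhRatio_le hc hMc⟩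

end

end DataHiding

end

theorem mainTheorem2 (nA nB n : ℕ) (hA : 0 < nA) (hB : 0 < nB) (hn : n = min nA nB) :
    (nA ≤ nB →
      (n : ℝ≥0∞) ≤ DataHiding.dhRatio (DataHiding.SEP (Fin nA) (Fin nB)) ∧
      DataHiding.dhRatio (DataHiding.SEP (Fin nA) (Fin nB)) ≤
        DataHiding.dhRatio (DataHiding.LOCC (Fin nA) (Fin nB)) ∧
      DataHiding.dhRatio (DataHiding.LOCC (Fin nA) (Fin nB)) ≤
        DataHiding.dhRatio (DataHiding.LOCCAtoB (Fin nA) (Fin nB)) ∧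
      DataHiding.dhRatio (DataHiding.LOCCAtoB (Fin nA) (Fin nB)) ≤
        ((2 * n - 1 : ℕ) : ℝ≥0∞)) ∧
    (nB ≤ nA →
      (n : ℝ≥0∞) ≤ DataHiding.dhRatio (DataHiding.SEP (Fin nA) (Fin nB)) ∧
      DataHiding.dhRatio (DataHiding.SEP (Fin nA) (Fin nB)) ≤
        DataHiding.dhRatio (DataHiding.LOCC (Fin nA) (Fin nB)) ∧
      DataHiding.dhRatio (DataHiding.LOCC (Fin nA) (Fin nB)) ≤
        DataHiding.dhRatio (DataHiding.LOCCBtoA (Fin nA) (Fin nB)) ∧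
      DataHiding.dhRatio (DataHiding.LOCCBtoA (Fin nA) (Fin nB)) ≤
        ((2 * n - 1 : ℕ) : ℝ≥0∞)) ∧
    (nA = nB → DataHiding.dhRatio (DataHiding.SEP (Fin nA) (Fin nB)) = (n : ℝ≥0∞)) := by
  have hA' : Nonempty (Fin nA) := ⟨⟨0, hA⟩⟩
  have hB' : Nonempty (Fin nB) := ⟨⟨0, hB⟩⟩
  have hn1 : 1 ≤ n := by omega
  have hn1' : (1 : ℝ) ≤ n := by exact_mod_cast hn1
  have hn' : Nonempty (Fin n) := ⟨⟨0, hn1⟩⟩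
  have hc : 0 < 2 * (n : ℝ) - 1 := by linarith
  have hcast : ((2 * n - 1 : ℕ) : ℝ≥0∞) = ENNReal.ofReal (2 * (n : ℝ) - 1) := by
    rw [← ENNReal.ofReal_natCast, Nat.cast_sub (by omega)]
    norm_num
  -- The Werner states live on the first n basis vectors of either party.
  have hf := Fin.castLE_injective (show n ≤ nA by omega)
  have hg := Fin.castLE_injective (show n ≤ nB by omega)
  have h1 : nA ≤ nB → _ := fun h => DataHiding.dhRatio_chain hf hg hc
    (fun ρ σ p hP => hP.errorProb_LOCC_le_of_subclass DataHiding.LOCCAtoB_le_LOCC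
      DataHiding.exists_mem_LOCCAtoB)
    fun ρ σ p hP => by
      have := hP.errorProb_LOCCAtoB_le
      rwa [Fintype.card_fin, show (nA : ℝ) = n from by exact_mod_cast (by omega : nA = n)] at this
  have h2 : nB ≤ nA → _ := fun h => DataHiding.dhRatio_chain hf hg hc
    (fun ρ σ p hP => hP.errorProb_LOCC_le_of_subclass DataHiding.LOCCBtoA_le_LOCC
      DataHiding.exists_mem_LOCCBtoA)
    fun ρ σ p hP => by
      have := hP.errorProb_LOCCBtoA_le
      rwa [Fintype.card_fin, show (nB : ℝ) = n from by exact_mod_cast (by omega : nB = n)] at this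
  rw [hcast]
  rw [Fintype.card_fin] at h1 h2
  refine ⟨h1, h2, fun h => le_antisymm ?_ (h1 h.le).1⟩
  rw [← ENNReal.ofReal_natCast]
  refine DataHiding.dhRatio_le (by linarith) fun ρ σ p hP => ?_
  have := hP.errorProb_SEP_le (by rw [Fintype.card_fin, Fintype.card_fin, h])
  rwa [Fintype.card_fin, show (nA : ℝ) = n from by exact_mod_cast (by omega : nA = n)] at this
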